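/- Let $n\in\mathbb N$, $d=n+1$, let $a=(a^0,\dots,a^n)\in\mathbb R^{d}$ have all components non-zero, let $0\neq q\in\mathbb R^d$, and let $\Theta$ be a real skew-symmetric $d\times d$ matrix (indices $0,\dots,n$) with $\Theta_{0j}=0$ for $j=1,\dots,n$. We write $a_\mu=a^\mu$ for the components of $a$, and index contractions are plain sums. *Operators.* On $\mathscr S(\mathbb R^d)\subset L^2(\mathbb R^d)$ let $Q^\mu$ be multiplication by the $\mu$-th coordinate and $P^\mu=-i\partial_\mu$, so that $[Q^\mu,P^\nu]=i\delta^{\mu\nu}$. The coordinates and differentials are represented by $$X^\mu=\tfrac{a^\mu}{2}(Q^\mu P^\mu+P^\mu Q^\mu)\ \text{(no sum)},\qquad dX^\mu=i\sum_b q_b[P^b,X^\mu].$$ Let $U(p)=\exp(i\sum_\mu p_\mu X^\mu)$ be the unitary group generated by the commuting $X^\mu$, that is, $(U(p)f)(x)=e^{\frac12\sum_\mu a^\mu p_\mu}f\big((e^{a^\mu p_\mu}x_\mu)_\mu\big)$, and let $\alpha_p(A)=U(p)AU(p)^{-1}$. Functions $f(X)$ of the commuting self-adjoint closures of the $X^\mu$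 are (unbounded) operators defined by the joint functional calculus, with their natural domains. *Deformation.* For an operator $A$ leaving $\mathscr S(\mathbb R^d)$ invariant, the warped convolution $A_\Theta$ is $$A_\Theta\Phi=(2\pi)^{-d}\lim_{\varepsilon\downarrow0}\iint \chi(\varepsilon x,\varepsilon y)\,e^{-i\sum_\mu x^\mu y_\mu}\,U(y)\,\alpha_{\Theta x}(A)\Phi\;dx\,dy,\qquad (\Theta x)_\mu=\Theta_{\mu\nu}x^\nu .$$ Its domain is the set of $\Phi\in\mathscr S(\mathbb R^d)$ for which these integrals converge absolutely for every $\varepsilon>0$ and the limit exists in $L^2(\mathbb R^d)$ with the same value for all cut-offs $\chi$. The cut-offs are the $\chi\in\mathscr S(\mathbb R^d\times\mathbb R^d)$ with $\chi(0,0)=1$ such that $\chi$ and its Fourier transform decay faster than every exponential. With $\eta=\mathrm{diag}(1,-1,\dots,-1)$, the deformed line-element is the operator $$(ds^2)_\Theta=\sum_{\mu,\nu:\ \eta_{\mu\nu}\ne0}\eta_{\mu\nu}\,(dX^\mu dX^\nu)_\Theta,$$ whose domain is the intersection of the domains of its terms. **Theorem.** Define $h_{ij}(\mathbf x)$ for $\mathbf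 x\in\mathbb R^n$, $1\le i,j\le n$, by $$h(\mathbf x)=\mathrm{diag}\big(e^{-2a_1(\Theta\mathbf x)_1},\dots,e^{-2a_n(\Theta\mathbf x)_n}\big),\qquad (\Theta\mathbf x)_i=\sum_{j=1}^n\Theta_{ij}x^j.$$ 1. With the metric $(\eta_{\mu\nu})_\Theta(x)=e^{-2a_\mu(\Theta x)_\mu}\eta_{\mu\nu}$ (no sum) one has $(ds^2)_\Theta=\sum_{\mu,\nu}(\eta_{\mu\nu})_\Theta(X)\,dX^\mu dX^\nu$ as operators (same domain in $\mathscr S(\mathbb R^d)$, same values). 2. This metric is ultra-static with spatial metric $h$: $h$ is a smooth Riemannian metric on $\mathbb R^n$, not depending on time, and $(\eta_{00})_\Theta=1$, $(\eta_{0i})_\Theta=(\eta_{i0})_\Theta=0$, $(\eta_{ij})_\Theta(x^0,\mathbf x)=-h_{ij}(\mathbf x)$. 3. With $dT=dX^0$ and $\mathbf X=(X^1,\dots,X^n)$, $$(ds^2)_\Theta=dT^2-\sum_{i,j=1}^n h_{ij}(\mathbf X)\,dX^i\,dX^j$$ as operators (same domain, same values). In every such sum the domain is the set of $\Phi\in\mathscr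 S(\mathbb R^d)$ lying in the domains of all terms. 4. On the domain of $(ds^2)_\Theta$, the warped convolution $\big(\sum_{\mu,\nu}\eta_{\mu\nu}dX^\mu dX^\nu\big)_\Theta$ of the whole flat line-element exists and equals $(ds^2)_\Theta$. 5. The domain of $(ds^2)_\Theta$ is dense in $L^2(\mathbb R^d)$. -/

import Mathlib

open scoped SchwartzMap FourierTransform LineDeriv Topology ContDiff

noncomputable section

namespace WarpedLineElement

/-! ### The Hilbert space, the Schroedinger representation, coordinates and differentials -/

/-- `ℝ^m` with its Euclidean structure. Space-time is `V (n + 1)`, the index `0` is time. -/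
abbrev V (m : ℕ) : Type := EuclideanSpace ℝ (Fin m)

/-- The Hilbert space `L²(ℝ^m)`. -/
abbrev Hilb (m : ℕ) : Type := MeasureTheory.Lp ℂ 2 (MeasureTheory.volume : MeasureTheory.Measure (V m))

/-- The class in `L²(ℝ^m)` of a Schwartz function. -/
abbrev ofSchwartz {m : ℕ} (φ : 𝓢(V m, ℂ)) : Hilb m := φ.toLp 2

/-- The position operator `Q^b`: multiplication by the `b`-th coordinate. -/
def posOp {m : ℕ} (b : Fin m) : Module.End ℂ 𝓢(V m, ℂ) :=
  (SchwartzMap.smulLeftCLM ℂ (fun x : V m => ((x b : ℝ) : ℂ)) : 𝓢(V m, ℂ) →L[ℂ] 𝓢(V m, ℂ))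

/-- The momentum operator `P^b = -i ∂/∂q_b`, so that `[Q^b, P^c] = i δ^{bc}`. -/
def momOp {m : ℕ} (b : Fin m) : Module.End ℂ 𝓢(V m, ℂ) :=
  (-Complex.I) •
    (LineDeriv.lineDerivOpCLM ℂ 𝓢(V m, ℂ) (EuclideanSpace.single b (1 : ℝ)) :
      𝓢(V m, ℂ) →ₗ[ℂ] 𝓢(V m, ℂ))

/-- The represented coordinate `X^μ = (a^μ / 2) (Q^μ P^μ + P^μ Q^μ)`. -/
def coordOp {m : ℕ} (a : Fin m → ℝ) (μ : Fin m) : Module.End ℂ 𝓢(V m, ℂ) :=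
  ((a μ : ℂ) / 2) • (posOp μ * momOp μ + momOp μ * posOp μ)

/-- The represented differential `dX^μ = i ∑_b q_b [P^b, X^μ]`. -/
def diffOp {m : ℕ} (a q : Fin m → ℝ) (μ : Fin m) : Module.End ℂ 𝓢(V m, ℂ) :=
  Complex.I • ∑ b, (q b : ℂ) • ⁅momOp b, coordOp a μ⁆

theorem posOp_apply {m : ℕ} (b : Fin m) (φ : 𝓢(V m, ℂ)) (x : V m) :
    posOp b φ x = x b * φ x := by
  have h : (fun x : V m => ((x b : ℝ) : ℂ)).HasTemperateGrowth :=
    (Complex.ofRealCLM.comp (EuclideanSpace.proj b : V m →L[ℝ] ℝ)).hasTemperateGrowth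
  exact SchwartzMap.smulLeftCLM_apply_apply h φ x

theorem momOp_apply {m : ℕ} (b : Fin m) (φ : 𝓢(V m, ℂ)) (x : V m) :
    momOp b φ x = -Complex.I * fderiv ℝ φ x (EuclideanSpace.single b 1) := by
  have h : ∀ ψ : 𝓢(V m, ℂ), ((-Complex.I) • ψ) x = -Complex.I * ψ x := fun _ => rfl
  rw [← SchwartzMap.lineDerivOp_apply_eq_fderiv]
  exact h _

/-! ### The unitary group `U(p) = exp(i p_μ X^μ)`

`X^μ` is `a^μ` times the generator of dilations in the `μ`-th variable, so
`(U(p) f)(x) = exp(½ ∑_μ a^μ p_μ) f(exp(a^μ p_μ) x_μ)`. -/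

/-- The dilation `x ↦ (exp(a^μ p_μ) x_μ)_μ` of `ℝ^m`. -/
def dilation {m : ℕ} (a : Fin m → ℝ) (p : V m) : V m ≃L[ℝ] V m :=
  LinearEquiv.toContinuousLinearEquiv
    { toFun := fun x => WithLp.toLp 2 fun μ => Real.exp (a μ * p μ) * x μ
      invFun := fun x => WithLp.toLp 2 fun μ => Real.exp (-(a μ * p μ)) * x μ
      map_add' := fun x y => by ext μ; simp [mul_add]
      map_smul' := fun c x => by ext μ; simp; ring
      left_inv := fun x => by ext μ; simp [← mul_assoc, ← Real.exp_add]
      right_inv := fun x => by ext μ; simp [← mul_assoc, ← Real.exp_add] }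

@[simp] theorem dilation_apply {m : ℕ} (a : Fin m → ℝ) (p x : V m) (μ : Fin m) :
    dilation a p x μ = Real.exp (a μ * p μ) * x μ := rfl

/-- The normalizing constant `exp(½ ∑_μ a^μ p_μ)`. -/
def dilationFactor {m : ℕ} (a : Fin m → ℝ) (p : V m) : ℝ :=
  Real.exp ((∑ μ, a μ * p μ) / 2)

/-- `U(p)` on Schwartz functions. -/
def unitaryS {m : ℕ} (a : Fin m → ℝ) (p : V m) : 𝓢(V m, ℂ) →L[ℂ] 𝓢(V m, ℂ) :=
  (dilationFactor a p : ℂ) • SchwartzMap.compCLMOfContinuousLinearEquiv ℂ (dilation a p)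

theorem unitaryS_apply {m : ℕ} (a : Fin m → ℝ) (p : V m) (φ : 𝓢(V m, ℂ)) (x : V m) :
    unitaryS a p φ x = dilationFactor a p * φ (dilation a p x) := by
  simp [unitaryS]

theorem det_dilation {m : ℕ} (a : Fin m → ℝ) (p : V m) :
    LinearMap.det ((dilation a p : V m →L[ℝ] V m) : V m →ₗ[ℝ] V m)
      = Real.exp (∑ μ, a μ * p μ) := by
  rw [← LinearMap.det_toMatrix (EuclideanSpace.basisFun (Fin m) ℝ).toBasis]
  have : LinearMap.toMatrix (EuclideanSpace.basisFun (Fin m) ℝ).toBasis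
      (EuclideanSpace.basisFun (Fin m) ℝ).toBasis
      ((dilation a p : V m →L[ℝ] V m) : V m →ₗ[ℝ] V m)
      = Matrix.diagonal fun μ => Real.exp (a μ * p μ) := by
    ext i j
    rw [LinearMap.toMatrix_apply]
    by_cases h : i = j
    · subst h; simp
    · simp [h]
  rw [this, Matrix.det_diagonal, Real.exp_sum]

theorem map_dilation {m : ℕ} (a : Fin m → ℝ) (p : V m) :
    MeasureTheory.Measure.map (dilation a p) (MeasureTheory.volume : MeasureTheory.Measure (V m))
      = ENNReal.ofReal (Real.exp (-∑ μ, a μ * p μ)) • MeasureTheory.volume := by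
  have h := MeasureTheory.Measure.map_linearMap_addHaar_eq_smul_addHaar
    (MeasureTheory.volume : MeasureTheory.Measure (V m))
    (f := ((dilation a p : V m →L[ℝ] V m) : V m →ₗ[ℝ] V m))
    (by rw [det_dilation]; exact (Real.exp_pos _).ne')
  rw [det_dilation, ← Real.exp_neg, abs_of_pos (Real.exp_pos _)] at h
  exact h

theorem quasiMeasurePreserving_dilation {m : ℕ} (a : Fin m → ℝ) (p : V m) :
    MeasureTheory.Measure.QuasiMeasurePreserving (dilation a p)
      (MeasureTheory.volume : MeasureTheory.Measure (V m)) MeasureTheory.volume :=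
  ⟨(dilation a p).continuous.measurable, by
    rw [map_dilation]; exact MeasureTheory.Measure.smul_absolutelyContinuous⟩

theorem eLpNorm_comp_dilation {m : ℕ} (a : Fin m → ℝ) (p : V m) (f : Hilb m) :
    MeasureTheory.eLpNorm (fun x => (dilationFactor a p : ℂ) * f (dilation a p x)) 2
      MeasureTheory.volume = MeasureTheory.eLpNorm f 2 MeasureTheory.volume := by
  have h1 : MeasureTheory.eLpNorm (fun x => f (dilation a p x)) 2 MeasureTheory.volume
      = MeasureTheory.eLpNorm f 2
        (MeasureTheory.Measure.map (dilation a p) MeasureTheory.volume) := by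
    rw [MeasureTheory.eLpNorm_map_measure]
    · rfl
    · exact (MeasureTheory.Lp.aestronglyMeasurable f).mono_ac
        (quasiMeasurePreserving_dilation a p).absolutelyContinuous
    · exact (dilation a p).continuous.measurable.aemeasurable
  have h2 : (fun x => (dilationFactor a p : ℂ) * f (dilation a p x))
      = (dilationFactor a p : ℂ) • (fun x => f (dilation a p x)) := rfl
  rw [h2, MeasureTheory.eLpNorm_const_smul, h1, map_dilation,
    MeasureTheory.eLpNorm_smul_measure_of_ne_top (by simp), smul_eq_mul, ← mul_assoc]
  convert one_mul _
  rw [ENNReal.ofReal_rpow_of_pos (Real.exp_pos _)]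
  have h3 : ‖(dilationFactor a p : ℂ)‖ₑ = ENNReal.ofReal (dilationFactor a p) := by
    rw [← ofReal_norm, Complex.norm_real, Real.norm_eq_abs, dilationFactor,
      abs_of_pos (Real.exp_pos _)]
  rw [h3, dilationFactor, ← ENNReal.ofReal_mul (Real.exp_pos _).le, ← Real.exp_mul,
    ← Real.exp_add]
  rw [← ENNReal.ofReal_one, ← Real.exp_zero]
  congr 2
  norm_num
  ring

theorem memLp_comp_dilation {m : ℕ} (a : Fin m → ℝ) (p : V m) (f : Hilb m) :
    MeasureTheory.MemLp (fun x => (dilationFactor a p : ℂ) * f (dilation a p x)) 2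
      MeasureTheory.volume :=
  ⟨((MeasureTheory.Lp.aestronglyMeasurable f).comp_quasiMeasurePreserving
      (quasiMeasurePreserving_dilation a p)).const_mul _, by
    rw [eLpNorm_comp_dilation]; exact MeasureTheory.Lp.eLpNorm_lt_top f⟩

/-- `U(p)` on `L²(ℝ^m)`. -/
def unitary {m : ℕ} (a : Fin m → ℝ) (p : V m) : Hilb m →ₗᵢ[ℂ] Hilb m where
  toFun f := (memLp_comp_dilation a p f).toLp _
  map_add' f g := by
    rw [← MeasureTheory.MemLp.toLp_add, MeasureTheory.MemLp.toLp_eq_toLp_iff]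
    filter_upwards [(quasiMeasurePreserving_dilation a p).ae
      (MeasureTheory.Lp.coeFn_add f g)] with x hx
    rw [hx]
    exact mul_add _ _ _
  map_smul' c f := by
    rw [RingHom.id_apply, ← MeasureTheory.MemLp.toLp_const_smul,
      MeasureTheory.MemLp.toLp_eq_toLp_iff]
    filter_upwards [(quasiMeasurePreserving_dilation a p).ae
      (MeasureTheory.Lp.coeFn_smul c f)] with x hx
    simp [hx]
    ring
  norm_map' f := by
    change ‖(memLp_comp_dilation a p f).toLp _‖ = _
    rw [MeasureTheory.Lp.norm_toLp, eLpNorm_comp_dilation, MeasureTheory.Lp.norm_def]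

/-- On Schwartz functions both definitions of `U(p)` agree. -/
theorem unitary_ofSchwartz {m : ℕ} (a : Fin m → ℝ) (p : V m) (φ : 𝓢(V m, ℂ)) :
    unitary a p (ofSchwartz φ) = ofSchwartz (unitaryS a p φ) := by
  change (memLp_comp_dilation a p (ofSchwartz φ)).toLp _ = _
  apply MeasureTheory.Lp.ext
  filter_upwards [MeasureTheory.MemLp.coeFn_toLp (memLp_comp_dilation a p (ofSchwartz φ)),
    SchwartzMap.coeFn_toLp (unitaryS a p φ) 2 MeasureTheory.volume,
    (quasiMeasurePreserving_dilation a p).ae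
      (SchwartzMap.coeFn_toLp φ 2 MeasureTheory.volume)] with x h1 h2 h3
  rw [h1, h2, h3, unitaryS_apply]

theorem coordOp_apply {m : ℕ} (a : Fin m → ℝ) (μ : Fin m) (φ : 𝓢(V m, ℂ)) (x : V m) :
    coordOp a μ φ x
      = -Complex.I * a μ * (x μ * fderiv ℝ φ x (EuclideanSpace.single μ 1) + φ x / 2) := by
  have h0 : coordOp a μ φ x
      = ((a μ : ℂ) / 2) * (posOp μ (momOp μ φ) x + momOp μ (posOp μ φ) x) := rfl
  have h1 : (posOp μ φ : V m → ℂ) = fun y => ((y μ : ℝ) : ℂ) * φ y := funext (posOp_apply μ φ)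
  have h2 : HasFDerivAt (fun y : V m => ((y μ : ℝ) : ℂ))
      (Complex.ofRealCLM.comp (EuclideanSpace.proj μ : V m →L[ℝ] ℝ)) x :=
    (Complex.ofRealCLM.comp (EuclideanSpace.proj μ : V m →L[ℝ] ℝ)).hasFDerivAt
  have h3 := (h2.mul (φ.differentiableAt (x := x)).hasFDerivAt).fderiv
  have h4 : fderiv ℝ (posOp μ φ) x (EuclideanSpace.single μ 1)
      = x μ * fderiv ℝ φ x (EuclideanSpace.single μ 1) + φ x := by
    rw [h1]
    erw [h3]
    simp
  rw [h0, posOp_apply, momOp_apply, momOp_apply, h4]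
  ring

/-- `U` solves `d/dt U(tp) φ = i p_μ X^μ U(tp) φ`, i.e. `U(p) = exp(i p_μ X^μ)`. -/
theorem hasDerivAt_unitaryS {m : ℕ} (a : Fin m → ℝ) (p : V m) (φ : 𝓢(V m, ℂ)) (x : V m)
    (t : ℝ) :
    HasDerivAt (fun s : ℝ => unitaryS a (s • p) φ x)
      (Complex.I * ∑ μ, (p μ : ℂ) * coordOp a μ (unitaryS a (t • p) φ) x) t := by
  set y : V m := dilation a (t • p) x with hy
  set L := fderiv ℝ φ y with hL
  set F : ℂ := (dilationFactor a (t • p) : ℂ) with hF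
  have hd : HasDerivAt (fun s : ℝ => dilation a (s • p) x)
      (WithLp.toLp 2 fun μ => a μ * p μ * y μ) t := by
    rw [hasDerivAt_iff_hasFDerivAt, ← hasFDerivWithinAt_univ, hasFDerivWithinAt_euclidean]
    intro μ
    rw [hasFDerivWithinAt_univ]
    have h : HasDerivAt (fun s : ℝ => Real.exp (a μ * (s * p μ)) * x μ)
        (Real.exp (a μ * (t * p μ)) * (a μ * (1 * p μ)) * x μ) t :=
      ((((hasDerivAt_id t).mul_const (p μ)).const_mul (a μ)).exp).mul_const (x μ)
    have h' : HasDerivAt (fun s : ℝ => dilation a (s • p) x μ) (a μ * p μ * y μ) t :=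
      h.congr_deriv (by simp [hy]; ring)
    refine h'.hasFDerivAt.congr_fderiv ?_
    ext
    simp
  have hf : HasDerivAt (fun s : ℝ => ((dilationFactor a (s • p) : ℝ) : ℂ))
      (F * ((∑ μ, a μ * p μ : ℝ) / 2 : ℂ)) t := by
    have h : HasDerivAt (fun s : ℝ => dilationFactor a (s • p))
        (dilationFactor a (t • p) * ((∑ μ, a μ * p μ) / 2)) t := by
      have e : (fun s : ℝ => dilationFactor a (s • p))
          = fun s : ℝ => Real.exp (s * ((∑ μ, a μ * p μ) / 2)) := by
        funext s
        rw [dilationFactor, mul_div_assoc', Finset.mul_sum]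
        congr 2
        refine Finset.sum_congr rfl fun μ _ => ?_
        simp
        ring
      rw [e, congrFun e t]
      simpa using ((hasDerivAt_id t).mul_const ((∑ μ, a μ * p μ) / 2)).exp
    convert h.ofReal_comp using 1
    push_cast
    rfl
  have hφ := (φ.differentiableAt (x := y)).hasFDerivAt.comp_hasDerivAt t hd
  have hU : (unitaryS a (t • p) φ : V m → ℂ) = fun z => F * φ (dilation a (t • p) z) :=
    funext (unitaryS_apply a (t • p) φ)
  have hDU : ∀ μ, fderiv ℝ (unitaryS a (t • p) φ) x (EuclideanSpace.single μ 1)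
      = F * (Real.exp (a μ * (t * p μ)) * L (EuclideanSpace.single μ 1)) := by
    intro μ
    have h1 : HasFDerivAt (fun z => F * φ (dilation a (t • p) z))
        (F • L.comp (dilation a (t • p) : V m →L[ℝ] V m)) x :=
      (((φ.differentiableAt (x := y)).hasFDerivAt).comp x
        (dilation a (t • p)).hasFDerivAt).const_mul F
    have h2 : dilation a (t • p) (EuclideanSpace.single μ 1)
        = Real.exp (a μ * (t * p μ)) • (EuclideanSpace.single μ 1 : V m) := by
      ext ν
      by_cases h : ν = μ
      · subst h; simp
      · simp [h]
    rw [hU, h1.fderiv]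
    change F • L (dilation a (t • p) (EuclideanSpace.single μ 1)) = _
    rw [h2, map_smul, smul_eq_mul, Complex.real_smul]
  have hsum : L (WithLp.toLp 2 fun μ => a μ * p μ * y μ)
      = ∑ μ, ((a μ * p μ * y μ : ℝ) : ℂ) * L (EuclideanSpace.single μ 1) := by
    have h : (WithLp.toLp 2 fun μ => a μ * p μ * y μ : V m)
        = ∑ μ, (a μ * p μ * y μ) • (EuclideanSpace.single μ 1 : V m) := by
      ext ν
      simp [Finset.sum_apply, Pi.single_apply]
    rw [h, map_sum]
    simp [Complex.real_smul]
  have hmain := hf.mul hφ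
  have e1 : (fun s : ℝ => unitaryS a (s • p) φ x)
      = (fun s : ℝ => ((dilationFactor a (s • p) : ℝ) : ℂ)) *
        ((φ : V m → ℂ) ∘ fun s : ℝ => dilation a (s • p) x) := by
    funext s
    exact unitaryS_apply a (s • p) φ x
  rw [e1]
  refine hmain.congr_deriv ?_
  symm
  rw [← hL, hsum]
  simp only [coordOp_apply, hDU, Function.comp]
  rw [congrFun hU x, ← hy]
  push_cast
  rw [Finset.sum_div, Finset.mul_sum, Finset.mul_sum, Finset.sum_mul, ← hF, Finset.mul_sum,
    ← Finset.sum_add_distrib]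
  refine Finset.sum_congr rfl fun μ _ => ?_
  have hyμ : y μ = Real.exp (a μ * (t * p μ)) * x μ := rfl
  rw [hyμ]
  push_cast
  linear_combination (-(p μ : ℂ) * a μ * (x μ * (F * (Complex.exp (a μ * (t * p μ)) *
    L (EuclideanSpace.single μ 1))) + F * φ y / 2)) * Complex.I_mul_I

/-! ### Warped convolution -/

/-- The action `α_p(A) = U(p) A U(p)⁻¹` on operators that leave the Schwartz space invariant. -/
def adjAction {m : ℕ} (a : Fin m → ℝ) (p : V m) (A : Module.End ℂ 𝓢(V m, ℂ)) :
    Module.End ℂ 𝓢(V m, ℂ) :=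
  (unitaryS a p : 𝓢(V m, ℂ) →ₗ[ℂ] 𝓢(V m, ℂ)) * A *
    (unitaryS a (-p) : 𝓢(V m, ℂ) →ₗ[ℂ] 𝓢(V m, ℂ))

/-- `(Θ x)_μ = Θ_{μν} x^ν`. -/
def applyMatrix {m : ℕ} (Θ : Matrix (Fin m) (Fin m) ℝ) (x : V m) : V m :=
  WithLp.toLp 2 (Θ.mulVec x.ofLp)

/-- Cut-off functions for the oscillatory integrals: Schwartz functions `χ` on `ℝ^m × ℝ^m` with
`χ(0,0) = 1` such that `χ` and its Fourier transform decay faster than every exponential (all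
Gaussians qualify). The adjoint action on the differentials grows exponentially, so that for an
arbitrary Schwartz cut-off the integrals need not converge. -/
def IsCutoff {m : ℕ} (χ : 𝓢(WithLp 2 (V m × V m), ℂ)) : Prop :=
  χ 0 = 1 ∧
  (∀ c : ℝ, ∃ C : ℝ, ∀ z, ‖χ z‖ ≤ C * Real.exp (-(c * ‖z‖))) ∧
  (∀ c : ℝ, ∃ C : ℝ, ∀ z, ‖(𝓕 χ : 𝓢(WithLp 2 (V m × V m), ℂ)) z‖ ≤ C * Real.exp (-(c * ‖z‖)))

/-- The integrand `χ(εx, εy) e^{-i x·y} U(y) α_{Θx}(A) Φ`. -/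
def warpedIntegrand {m : ℕ} (a : Fin m → ℝ) (Θ : Matrix (Fin m) (Fin m) ℝ)
    (A : Module.End ℂ 𝓢(V m, ℂ)) (Φ : 𝓢(V m, ℂ)) (χ : 𝓢(WithLp 2 (V m × V m), ℂ)) (ε : ℝ)
    (z : V m × V m) : Hilb m :=
  (χ (WithLp.toLp 2 (ε • z.1, ε • z.2)) *
      Complex.exp (-(Complex.I * ((∑ μ, z.1 μ * z.2 μ : ℝ) : ℂ)))) •
    unitary a z.2 (ofSchwartz (adjAction a (applyMatrix Θ z.1) A Φ))

/-- `Φ` lies in the domain of the warped convolution `A_Θ`, and `A_Θ Φ = w`: for every cut-off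
function `χ` the integrals below converge absolutely, and
`w = lim_{ε → 0} (2π)^{-m} ∬ χ(εx, εy) e^{-i x·y} U(y) α_{Θx}(A) Φ dx dy` in `L²(ℝ^m)`. -/
def HasWarpedConvolution {m : ℕ} (a : Fin m → ℝ) (Θ : Matrix (Fin m) (Fin m) ℝ)
    (A : Module.End ℂ 𝓢(V m, ℂ)) (Φ : 𝓢(V m, ℂ)) (w : Hilb m) : Prop :=
  ∀ χ : 𝓢(WithLp 2 (V m × V m), ℂ), IsCutoff χ →
    (∀ ε : ℝ, 0 < ε → MeasureTheory.Integrable (warpedIntegrand a Θ A Φ χ ε)) ∧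
    Filter.Tendsto (fun ε : ℝ => (((2 * Real.pi) ^ m)⁻¹ : ℝ) • ∫ z, warpedIntegrand a Θ A Φ χ ε z)
      (𝓝[>] 0) (𝓝 w)

/-! ### Functions of the commuting operators `X^0, …, X^n` -/

/-- `g(X) w` for a Schwartz function `g`, by Fourier inversion:
`g(x) = ∫ ĝ(p) e^{2πi p·x} dp` gives `g(X) = ∫ ĝ(p) U(2πp) dp`. -/
def schwartzFunction {m : ℕ} (a : Fin m → ℝ) (g : 𝓢(V m, ℂ)) (w : Hilb m) : Hilb m :=
  ∫ p : V m, (𝓕 g : 𝓢(V m, ℂ)) p • unitary a ((2 * Real.pi) • p) w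

/-- For a smooth function `f` on `ℝ^m`: `v` lies in the domain of the (in general unbounded)
operator `f(X)`, and `f(X) v = w`. Namely `(f g)(X) v = g(X) w` for all Schwartz functions `g` for
which `f g` is a Schwartz function, in particular for all compactly supported smooth `g`; in terms
of the joint spectral measure `E` of `X` this says `∫ |f|² d⟨v, E v⟩ < ∞` and `w = ∫ f dE v`. -/
def HasFunctionValue {m : ℕ} (a : Fin m → ℝ) (f : V m → ℝ) (v w : Hilb m) : Prop :=
  ∀ g k : 𝓢(V m, ℂ), (∀ x, k x = f x * g x) → schwartzFunction a k v = schwartzFunction a g w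

/-! ### Line elements -/

/-- The Minkowski metric `diag(1, -1, …, -1)`. -/
def minkowski (n : ℕ) : Matrix (Fin (n + 1)) (Fin (n + 1)) ℝ :=
  Matrix.diagonal (Fin.cons 1 fun _ => -1)

/-- The flat line element `η_{μν} dX^μ dX^ν`. -/
def flatLineElement {n : ℕ} (a q : Fin (n + 1) → ℝ) : Module.End ℂ 𝓢(V (n + 1), ℂ) :=
  ∑ μ, ∑ ν, (minkowski n μ ν : ℂ) • (diffOp a q μ * diffOp a q ν)

/-- The deformed line element `(ds²)_Θ = η_{μν} (dX^μ dX^ν)_Θ`, the sum being over the `μ, ν` with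
`η_{μν} ≠ 0`: `Φ` lies in its domain, and its value on `Φ` is `v`. -/
def HasDeformedLineElement {n : ℕ} (a q : Fin (n + 1) → ℝ)
    (Θ : Matrix (Fin (n + 1)) (Fin (n + 1)) ℝ) (Φ : 𝓢(V (n + 1), ℂ)) (v : Hilb (n + 1)) : Prop :=
  ∃ w : Fin (n + 1) → Fin (n + 1) → Hilb (n + 1),
    (∀ μ ν, minkowski n μ ν ≠ 0 →
      HasWarpedConvolution a Θ (diffOp a q μ * diffOp a q ν) Φ (w μ ν)) ∧
    v = ∑ μ, ∑ ν, minkowski n μ ν • w μ ν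

/-- The line element `g_{μν}(X) dX^μ dX^ν` of a metric `g`: `Φ` lies in its domain, and its value
on `Φ` is `v`. -/
def HasLineElement {n : ℕ} (a q : Fin (n + 1) → ℝ)
    (g : V (n + 1) → Matrix (Fin (n + 1)) (Fin (n + 1)) ℝ) (Φ : 𝓢(V (n + 1), ℂ))
    (v : Hilb (n + 1)) : Prop :=
  ∃ w : Fin (n + 1) → Fin (n + 1) → Hilb (n + 1),
    (∀ μ ν, HasFunctionValue a (fun x => g x μ ν)
      (ofSchwartz (diffOp a q μ (diffOp a q ν Φ))) (w μ ν)) ∧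
    v = ∑ μ, ∑ ν, w μ ν

/-- The spatial part of a point of space-time. -/
def spatial {n : ℕ} (x : V (n + 1)) : V n := WithLp.toLp 2 fun i => x i.succ

/-- The line element `dT² - h_{ij}(X^1, …, X^n) dX^i dX^j`, where `dT = dX^0`: `Φ` lies in its
domain, and its value on `Φ` is `v`. -/
def HasUltraStaticLineElement {n : ℕ} (a q : Fin (n + 1) → ℝ)
    (h : V n → Matrix (Fin n) (Fin n) ℝ) (Φ : 𝓢(V (n + 1), ℂ)) (v : Hilb (n + 1)) : Prop :=
  ∃ w : Fin n → Fin n → Hilb (n + 1),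
    (∀ i j, HasFunctionValue a (fun x => h (spatial x) i j)
      (ofSchwartz (diffOp a q i.succ (diffOp a q j.succ Φ))) (w i j)) ∧
    v = ofSchwartz (diffOp a q 0 (diffOp a q 0 Φ)) - ∑ i, ∑ j, w i j

/-- The metric `g` on `ℝ^(n+1)` is ultra-static with spatial metric `h`: `h` is a smooth Riemannian
metric on `ℝ^n`, and `g = dt² - h_{ij} dx^i dx^j`. -/
def IsUltraStatic {n : ℕ} (g : V (n + 1) → Matrix (Fin (n + 1)) (Fin (n + 1)) ℝ)
    (h : V n → Matrix (Fin n) (Fin n) ℝ) : Prop :=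
  (∀ i j, ContDiff ℝ ∞ fun x => h x i j) ∧ (∀ x, (h x).PosDef) ∧
  ∀ x, g x 0 0 = 1 ∧ (∀ i : Fin n, g x 0 i.succ = 0 ∧ g x i.succ 0 = 0) ∧
    ∀ i j : Fin n, g x i.succ j.succ = -h (spatial x) i j

/-- The curved metric `(η_{μν})_Θ = exp(-2 a_μ (Θ x)_μ) η_{μν}` (no sum over `μ`). -/
def deformedMetric {n : ℕ} (a : Fin (n + 1) → ℝ) (Θ : Matrix (Fin (n + 1)) (Fin (n + 1)) ℝ)
    (x : V (n + 1)) : Matrix (Fin (n + 1)) (Fin (n + 1)) ℝ :=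
  Matrix.of fun μ ν => Real.exp (-2 * a μ * applyMatrix Θ x μ) * minkowski n μ ν

/-- The spatial metric `h = diag(exp(-2 a_i (Θ x)_i))`, where `(Θ x)_i = ∑_{j=1}^n Θ_{ij} x^j`. -/
def spatialMetric {n : ℕ} (a : Fin (n + 1) → ℝ) (Θ : Matrix (Fin (n + 1)) (Fin (n + 1)) ℝ)
    (x : V n) : Matrix (Fin n) (Fin n) ℝ :=
  Matrix.diagonal fun i => Real.exp (-2 * a i.succ * ∑ j : Fin n, Θ i.succ j.succ * x j)

end WarpedLineElement

end

noncomputable section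

namespace WarpedLineElement

open MeasureTheory

variable {m : ℕ}

/-! ### The unitary group -/

/-! The canonical commutation relations give `dX^μ = a^μ q_μ P^μ` (`diffOp_eq`), and `U(p)` is a
dilation, so `α_p((dX^μ)²) = e^{-2 a_μ p_μ} (dX^μ)²` (`adjAction_diffOp`). For `p = Θx` the operator
under the warped convolution integral is therefore a scalar `e^{k·x}`, with `k = warpVector a Θ μ`,
times the fixed vector `v = (dX^μ)²Φ`. Formally the oscillatory integral replaces `x` by `X` and
returns `e^{k·X} v`, which is the coefficient of the curved metric. Since `η` is diagonal, only
these squares occur.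

The analytic core is `tendsto_warp_iff`: the limit exists exactly when `v` lies in the domain of the
unbounded operator `e^{k·X}`. Let `W_ε v` be the regularized integral. Fourier inversion in one
variable (`integral_warpWeight`) shows that its symbol at `s` is `e^{k·s}` times the symbol of a
bounded operator `R_ε`, an integral of unitaries against a weight built from the Fourier transform
of the cut-off. Hence `g(X) W_ε v = (e^k g)(X) R_ε v` whenever `g` and `e^k g` are Schwartz
(`schwartzFunction_warp`), and `R_ε → 1` strongly (`tendsto_reg`). Passing to the limit gives one
direction. Conversely, if `e^{k·X} v = w`, then `g(X) W_ε v = g(X) R_ε w` for all such `g`; these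
`g(X)` separate vectors (`eq_of_schwartzFunction_eq`), so `W_ε v = R_ε w → w`. No spectral measure
is needed: all operators are integrals of `U(p)`, multiplied by means of Fubini and the Fourier
transform (`schwartzFunction_integral`).

All three line elements are then compared with one diagonal form, `HasDiagonalLineElement`.
Skew-symmetry and `Θ_{0j} = 0` make row and column `0` of `Θ` vanish, which makes the time
coefficient `1` and the spatial ones independent of time. The whole flat line element is handled by
linearity.

For density, a Schwartz `φ` is replaced by `Φ = g(X)φ` with `g` a Gaussian. The Fourier transform of
`g` beats the exponential growth of the dilations, so `Φ` is Schwartz; moreover `(dX^μ)²Φ` is again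
a Gaussian function of `X` applied to a vector, hence in the domain of every `e^{k·X}`. Widening the
Gaussian gives `Φ → φ`. -/

theorem dilation_add (a : Fin m → ℝ) (p q x : V m) :
    dilation a (p + q) x = dilation a q (dilation a p x) := by
  ext μ
  simp only [dilation_apply, PiLp.add_apply, mul_add, Real.exp_add]
  ring

theorem dilationFactor_add (a : Fin m → ℝ) (p q : V m) :
    dilationFactor a (p + q) = dilationFactor a p * dilationFactor a q := by
  simp only [dilationFactor, PiLp.add_apply, mul_add, Finset.sum_add_distrib, add_div,
    Real.exp_add]

theorem dilationFactor_pos (a : Fin m → ℝ) (p : V m) : 0 < dilationFactor a p :=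
  Real.exp_pos _

theorem continuous_dilationFactor (a : Fin m → ℝ) : Continuous (dilationFactor a) := by
  unfold dilationFactor
  fun_prop

theorem continuous_dilation (a : Fin m → ℝ) (x : V m) : Continuous fun p => dilation a p x := by
  refine (PiLp.continuous_toLp 2 _).comp (continuous_pi fun μ => ?_)
  fun_prop

theorem dilation_zero (a : Fin m → ℝ) (x : V m) : dilation a 0 x = x := by
  ext μ; simp

theorem dilationFactor_zero (a : Fin m → ℝ) : dilationFactor a 0 = 1 := by
  simp [dilationFactor]

theorem denseRange_ofSchwartz : DenseRange (ofSchwartz : 𝓢(V m, ℂ) → Hilb m) :=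
  SchwartzMap.denseRange_toLpCLM (E := V m) (F := ℂ) (p := 2) (μ := volume) (by simp)

theorem unitaryS_add (a : Fin m → ℝ) (p q : V m) (φ : 𝓢(V m, ℂ)) :
    unitaryS a (p + q) φ = unitaryS a p (unitaryS a q φ) := by
  ext x
  rw [unitaryS_apply, unitaryS_apply, unitaryS_apply, dilation_add, dilationFactor_add]
  push_cast
  ring

theorem unitaryS_zero (a : Fin m → ℝ) (φ : 𝓢(V m, ℂ)) : unitaryS a 0 φ = φ := by
  ext x
  rw [unitaryS_apply, dilation_zero, dilationFactor_zero]
  simp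

theorem unitary_add (a : Fin m → ℝ) (p q : V m) (f : Hilb m) :
    unitary a (p + q) f = unitary a p (unitary a q f) := by
  refine congrFun (denseRange_ofSchwartz.equalizer (unitary a (p + q)).continuous
    ((unitary a p).continuous.comp (unitary a q).continuous) ?_) f
  funext φ
  simp only [Function.comp_apply, unitary_ofSchwartz, unitaryS_add]

theorem unitary_zero (a : Fin m → ℝ) (f : Hilb m) : unitary a 0 f = f := by
  refine congrFun (denseRange_ofSchwartz.equalizer (unitary a 0).continuous continuous_id ?_) f
  funext φ
  simp only [Function.comp_apply, unitary_ofSchwartz, unitaryS_zero, id]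

/-- Dominated convergence. Continuity of this matrix element at `0` is enough for strong continuity,
because `U(p)` is isometric. -/
theorem continuous_inner_unitaryS (a : Fin m → ℝ) (φ : 𝓢(V m, ℂ)) :
    ContinuousAt (fun p => inner ℂ (ofSchwartz (unitaryS a p φ)) (ofSchwartz φ)) 0 := by
  simp only [SchwartzMap.inner_toL2_toL2_eq]
  refine continuousAt_of_dominated
    -- The factor `2` bounds `dilationFactor`, which is close to `1` near `p = 0`.
    (bound := fun x => 2 * (SchwartzMap.seminorm ℝ 0 0 φ) * ‖φ x‖)
    (Filter.Eventually.of_forall fun p => ?_) ?_ ?_ ?_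
  · exact ((unitaryS a p φ).continuous.inner φ.continuous).aestronglyMeasurable
  · have h : ∀ᶠ p in 𝓝 (0 : V m), dilationFactor a p < 2 := by
      apply (continuous_dilationFactor a).continuousAt.eventually_lt continuousAt_const
      rw [dilationFactor_zero]; norm_num
    filter_upwards [h] with p hp
    refine Filter.Eventually.of_forall fun x => (norm_inner_le_norm _ _).trans ?_
    gcongr
    rw [unitaryS_apply, norm_mul, Complex.norm_real, Real.norm_of_nonneg (dilationFactor_pos a p).le]
    gcongr
    exact SchwartzMap.norm_le_seminorm ℝ φ _
  · exact (φ.integrable (μ := volume)).norm.const_mul _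
  · refine Filter.Eventually.of_forall fun x => ?_
    simp only [unitaryS_apply]
    refine Continuous.continuousAt (Continuous.inner ?_ continuous_const)
    exact (Complex.continuous_ofReal.comp (continuous_dilationFactor a)).mul
      (φ.continuous.comp (continuous_dilation a x))

theorem tendsto_unitary_ofSchwartz (a : Fin m → ℝ) (φ : 𝓢(V m, ℂ)) :
    Filter.Tendsto (fun p => unitary a p (ofSchwartz φ)) (𝓝 0) (𝓝 (ofSchwartz φ)) := by
  rw [tendsto_iff_norm_sub_tendsto_zero]
  have key : ∀ p, ‖unitary a p (ofSchwartz φ) - ofSchwartz φ‖ ^ 2 = 2 * ‖ofSchwartz φ‖ ^ 2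
      - 2 * RCLike.re (inner ℂ (ofSchwartz (unitaryS a p φ)) (ofSchwartz φ)) := by
    intro p
    rw [norm_sub_sq (𝕜 := ℂ), LinearIsometry.norm_map, unitary_ofSchwartz]
    ring
  have h := (((RCLike.continuous_re.tendsto _).comp
    (continuous_inner_unitaryS a φ).tendsto).const_mul 2).const_sub (2 * ‖ofSchwartz φ‖ ^ 2)
  have h0 : Filter.Tendsto (fun p => ‖unitary a p (ofSchwartz φ) - ofSchwartz φ‖ ^ 2)
      (𝓝 0) (𝓝 0) := by
    simp only [key]
    have e : 2 * ‖ofSchwartz φ‖ ^ 2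
        - 2 * RCLike.re (inner ℂ (ofSchwartz (unitaryS a 0 φ)) (ofSchwartz φ)) = 0 := by
      rw [unitaryS_zero, inner_self_eq_norm_sq]
      ring
    rw [← e]
    exact h
  have h1 := h0.sqrt
  simpa using h1

theorem tendsto_unitary (a : Fin m → ℝ) (f : Hilb m) :
    Filter.Tendsto (fun p => unitary a p f) (𝓝 0) (𝓝 f) := by
  rw [Metric.tendsto_nhds]
  intro ε hε
  obtain ⟨φ, hφ⟩ := denseRange_ofSchwartz.exists_dist_lt f (show 0 < ε / 3 by positivity)
  filter_upwards [Metric.tendsto_nhds.1 (tendsto_unitary_ofSchwartz a φ) (ε / 3) (by positivity)]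
    with p hp
  calc dist (unitary a p f) f
      ≤ dist (unitary a p f) (unitary a p (ofSchwartz φ))
        + dist (unitary a p (ofSchwartz φ)) (ofSchwartz φ) + dist (ofSchwartz φ) f :=
        dist_triangle4 _ _ _ _
    _ < ε / 3 + ε / 3 + ε / 3 := by
        rw [LinearIsometry.dist_map, dist_comm (ofSchwartz φ) f]
        gcongr
    _ = ε := by ring

/-- The unitary group is strongly continuous. -/
theorem continuous_unitary (a : Fin m → ℝ) (f : Hilb m) : Continuous fun p => unitary a p f := by
  rw [continuous_iff_continuousAt]
  intro p₀
  have h1 : Filter.Tendsto (fun p : V m => p - p₀) (𝓝 p₀) (𝓝 0) := by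
    have h : Continuous fun p : V m => p - p₀ := by fun_prop
    simpa using h.tendsto p₀
  have h2 := ((unitary a p₀).continuous.tendsto f).comp ((tendsto_unitary a f).comp h1)
  refine Filter.Tendsto.congr (fun p => ?_) h2
  simp only [Function.comp_apply]
  rw [← unitary_add]
  simp

/-! ### The Fourier functional calculus -/

/-- `exp(2πi p·X)`. -/
def phaseOp (a : Fin m → ℝ) (p : V m) : Hilb m →ₗᵢ[ℂ] Hilb m := unitary a ((2 * Real.pi) • p)

theorem phaseOp_add (a : Fin m → ℝ) (p q : V m) (f : Hilb m) :
    phaseOp a (p + q) f = phaseOp a p (phaseOp a q f) := by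
  rw [phaseOp, smul_add, unitary_add]; rfl

theorem phaseOp_comm (a : Fin m → ℝ) (p q : V m) (f : Hilb m) :
    phaseOp a p (phaseOp a q f) = phaseOp a q (phaseOp a p f) := by
  rw [← phaseOp_add, ← phaseOp_add, add_comm]

theorem phaseOp_zero (a : Fin m → ℝ) (f : Hilb m) : phaseOp a 0 f = f := by
  rw [phaseOp, smul_zero, unitary_zero]

theorem continuous_phaseOp (a : Fin m → ℝ) (f : Hilb m) : Continuous fun p => phaseOp a p f :=
  (continuous_unitary a f).comp (continuous_const_smul _)

theorem schwartzFunction_eq (a : Fin m → ℝ) (g : 𝓢(V m, ℂ)) (w : Hilb m) :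
    schwartzFunction a g w = ∫ p, (𝓕 g : 𝓢(V m, ℂ)) p • phaseOp a p w := rfl

theorem integrable_smul_phaseOp {Z : Type*} [MeasurableSpace Z] {ν : Measure Z} (a : Fin m → ℝ)
    {c : Z → ℂ} (hc : Integrable c ν) {τ : Z → V m} (hτ : Measurable τ) (v : Hilb m) :
    Integrable (fun z => c z • phaseOp a (τ z) v) ν := by
  refine (hc.norm.mul_const ‖v‖).mono' ?_ ?_
  · exact hc.aestronglyMeasurable.smul
      ((continuous_phaseOp a v).stronglyMeasurable.comp_measurable hτ).aestronglyMeasurable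
  · refine Filter.Eventually.of_forall fun z => ?_
    rw [norm_smul, LinearIsometry.norm_map]

theorem norm_schwartzFunction_le (a : Fin m → ℝ) (g : 𝓢(V m, ℂ)) (w : Hilb m) :
    ‖schwartzFunction a g w‖ ≤ (∫ p, ‖(𝓕 g : 𝓢(V m, ℂ)) p‖) * ‖w‖ := by
  rw [schwartzFunction_eq, ← integral_mul_const]
  refine (norm_integral_le_integral_norm _).trans_eq ?_
  simp only [norm_smul, LinearIsometry.norm_map]

/-- `g(X)` as a bounded operator. -/
def schwartzFunctionCLM (a : Fin m → ℝ) (g : 𝓢(V m, ℂ)) : Hilb m →L[ℂ] Hilb m :=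
  LinearMap.mkContinuous
    { toFun := schwartzFunction a g
      map_add' := fun v w => by
        simp only [schwartzFunction_eq, map_add, smul_add]
        exact integral_add
          (integrable_smul_phaseOp a (SchwartzMap.integrable _) measurable_id v)
          (integrable_smul_phaseOp a (SchwartzMap.integrable _) measurable_id w)
      map_smul' := fun c v => by
        simp only [schwartzFunction_eq, map_smul, RingHom.id_apply, smul_comm _ c]
        exact integral_smul _ _ }
    (∫ p, ‖(𝓕 g : 𝓢(V m, ℂ)) p‖) (norm_schwartzFunction_le a g)

@[simp] theorem schwartzFunctionCLM_apply (a : Fin m → ℝ) (g : 𝓢(V m, ℂ)) (w : Hilb m) :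
    schwartzFunctionCLM a g w = schwartzFunction a g w := rfl

theorem phaseOp_schwartzFunction (a : Fin m → ℝ) (g : 𝓢(V m, ℂ)) (q : V m) (w : Hilb m) :
    phaseOp a q (schwartzFunction a g w) = schwartzFunction a g (phaseOp a q w) := by
  rw [schwartzFunction_eq, schwartzFunction_eq]
  change (phaseOp a q).toContinuousLinearMap _ = _
  refine (ContinuousLinearMap.integral_comp_comm _
    (integrable_smul_phaseOp a (SchwartzMap.integrable _) measurable_id w)).symm.trans ?_
  refine integral_congr_ae (Filter.Eventually.of_forall fun p => ?_)
  simp [phaseOp_comm a q p]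

/-- All the unitaries commute, and the bounded operator `g(X)` passes through Bochner integrals. -/
theorem schwartzFunction_integral_comm {Z : Type*} [MeasurableSpace Z] {ν : Measure Z}
    (a : Fin m → ℝ) {c : Z → ℂ} (hc : Integrable c ν) {τ : Z → V m} (hτ : Measurable τ)
    (g : 𝓢(V m, ℂ)) (v : Hilb m) :
    schwartzFunction a g (∫ z, c z • phaseOp a (τ z) v ∂ν)
      = ∫ z, c z • phaseOp a (τ z) (schwartzFunction a g v) ∂ν := by
  rw [← schwartzFunctionCLM_apply, ← ContinuousLinearMap.integral_comp_comm _
    (integrable_smul_phaseOp a hc hτ v)]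
  simp [phaseOp_schwartzFunction]

/-- The product of `g(X)` with an integral of unitaries is again an integral of unitaries, and the
corresponding functions multiply. -/
theorem schwartzFunction_integral {Z : Type*} [MeasurableSpace Z] {ν : Measure Z} [SFinite ν]
    (a : Fin m → ℝ) {c : Z → ℂ} (hc : Integrable c ν) {τ : Z → V m} (hτ : Measurable τ)
    (g : 𝓢(V m, ℂ)) (v : Hilb m) :
    schwartzFunction a g (∫ z, c z • phaseOp a (τ z) v ∂ν)
      = ∫ p, 𝓕 (fun s => g s *
          ∫ z, c z * Complex.exp (2 * Real.pi * Complex.I * inner ℝ (τ z) s) ∂ν) p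
            • phaseOp a p v := by
  set G : 𝓢(V m, ℂ) := 𝓕 g with hG
  have hGi : Integrable (G : V m → ℂ) := G.integrable
  have hmeas : AEStronglyMeasurable (fun x : Z × V m => (c x.1 * G (x.2 - τ x.1)) • phaseOp a x.2 v)
      (ν.prod volume) := by
    refine (hc.aestronglyMeasurable.comp_fst.mul ?_).smul ?_
    · exact (G.continuous.stronglyMeasurable.comp_measurable
        (measurable_snd.sub (hτ.comp measurable_fst))).aestronglyMeasurable
    · exact ((continuous_phaseOp a v).stronglyMeasurable.comp_measurable
        measurable_snd).aestronglyMeasurable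
  have hint : Integrable (fun x : Z × V m => (c x.1 * G (x.2 - τ x.1)) • phaseOp a x.2 v)
      (ν.prod volume) := by
    rw [integrable_prod_iff hmeas]
    constructor
    · refine Filter.Eventually.of_forall fun z => ?_
      exact integrable_smul_phaseOp a ((hGi.comp_sub_right (τ z)).const_mul (c z)) measurable_id v
    · simp only [norm_smul, norm_mul, LinearIsometry.norm_map]
      have : ∀ z, ∫ p, ‖c z‖ * ‖G (p - τ z)‖ * ‖v‖ = ‖c z‖ * ((∫ p, ‖G p‖) * ‖v‖) := by
        intro z
        rw [integral_mul_const, integral_const_mul,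
          integral_sub_right_eq_self (fun p => ‖G p‖) (τ z), mul_assoc]
      simp only [this]
      exact hc.norm.mul_const _
  -- The group law and the translation `p ↦ p - τ z` turn the product of operators into a
  -- convolution of weights.
  have h1 : schwartzFunction a g (∫ z, c z • phaseOp a (τ z) v ∂ν)
      = ∫ z, (∫ p, (c z * G (p - τ z)) • phaseOp a p v) ∂ν := by
    rw [schwartzFunction_integral_comm a hc hτ]
    refine integral_congr_ae (Filter.Eventually.of_forall fun z => ?_)
    simp only
    rw [phaseOp_schwartzFunction, schwartzFunction_eq, ← integral_smul]
    refine (integral_sub_right_eq_self (fun p => c z • G p • phaseOp a p (phaseOp a (τ z) v))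
      (τ z)).symm.trans ?_
    refine integral_congr_ae (Filter.Eventually.of_forall fun p => ?_)
    simp only
    rw [← phaseOp_add, sub_add_cancel, smul_smul]
  rw [h1, integral_integral_swap hint]
  refine integral_congr_ae (Filter.Eventually.of_forall fun p => ?_)
  simp only
  rw [integral_smul_const]
  congr 1
  -- Translating the Fourier transform of `g` modulates `g`; after Fubini the convolution becomes
  -- the Fourier transform of a product.
  have h2 : ∀ z, c z * G (p - τ z)
      = ∫ s, Complex.exp (((-2 * Real.pi * inner ℝ s p : ℝ) : ℂ) * Complex.I) * g s *
          (c z * Complex.exp (2 * Real.pi * Complex.I * inner ℝ (τ z) s)) := by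
    intro z
    rw [hG, SchwartzMap.fourier_coe, Real.fourier_eq', ← integral_const_mul]
    refine integral_congr_ae (Filter.Eventually.of_forall fun s => ?_)
    simp only
    rw [inner_sub_right, smul_eq_mul, real_inner_comm s (τ z)]
    have : Complex.exp (((-2 * Real.pi * (inner ℝ s p - inner ℝ s (τ z)) : ℝ) : ℂ) * Complex.I)
        = Complex.exp (((-2 * Real.pi * inner ℝ s p : ℝ) : ℂ) * Complex.I) *
          Complex.exp (2 * Real.pi * Complex.I * inner ℝ s (τ z)) := by
      rw [← Complex.exp_add]
      congr 1
      push_cast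
      ring
    rw [this]
    ring
  simp only [h2]
  rw [integral_integral_swap, Real.fourier_eq']
  · refine integral_congr_ae (Filter.Eventually.of_forall fun s => ?_)
    simp only
    rw [integral_const_mul, smul_eq_mul, mul_assoc]
  · have hprod : Integrable (fun x : Z × V m => c x.1 * g x.2) (ν.prod volume) :=
      hc.mul_prod (g.integrable (μ := volume))
    refine hprod.norm.mono' ?_ (Filter.Eventually.of_forall fun x => ?_)
    · refine AEStronglyMeasurable.mul (Measurable.aestronglyMeasurable ?_)
        (hc.aestronglyMeasurable.comp_fst.mul (Measurable.aestronglyMeasurable ?_))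
      · refine Continuous.measurable ?_ |>.comp measurable_snd (g := fun s : V m =>
          Complex.exp (((-2 * Real.pi * inner ℝ s p : ℝ) : ℂ) * Complex.I) * g s)
        have := g.continuous
        fun_prop
      · have : Measurable fun x : Z × V m => inner ℝ (τ x.1) x.2 :=
          (hτ.comp measurable_fst).inner measurable_snd
        fun_prop
    · simp only [Function.uncurry, norm_mul]
      rw [Complex.norm_exp_ofReal_mul_I]
      have : Complex.exp (2 * Real.pi * Complex.I * inner ℝ (τ x.1) x.2)
          = Complex.exp (((2 * Real.pi * inner ℝ (τ x.1) x.2 : ℝ) : ℂ) * Complex.I) := by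
        congr 1; push_cast; ring
      rw [this, Complex.norm_exp_ofReal_mul_I]
      apply le_of_eq
      ring

/-- If `g₁ M₁ = g₂ M₂` then `g₁(X) M₁(X) = g₂(X) M₂(X)`, where `M₁`, `M₂` are Fourier transforms of
finite measures. -/
theorem schwartzFunction_integral_eq {Z Z' : Type*} [MeasurableSpace Z] [MeasurableSpace Z']
    {ν : Measure Z} [SFinite ν] {ν' : Measure Z'} [SFinite ν']
    (a : Fin m → ℝ) {c : Z → ℂ} (hc : Integrable c ν) {τ : Z → V m} (hτ : Measurable τ)
    {c' : Z' → ℂ} (hc' : Integrable c' ν') {τ' : Z' → V m} (hτ' : Measurable τ')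
    (g g' : 𝓢(V m, ℂ)) (v : Hilb m)
    (h : ∀ s, g s * ∫ z, c z * Complex.exp (2 * Real.pi * Complex.I * inner ℝ (τ z) s) ∂ν
      = g' s * ∫ z, c' z * Complex.exp (2 * Real.pi * Complex.I * inner ℝ (τ' z) s) ∂ν') :
    schwartzFunction a g (∫ z, c z • phaseOp a (τ z) v ∂ν)
      = schwartzFunction a g' (∫ z, c' z • phaseOp a (τ' z) v ∂ν') := by
  rw [schwartzFunction_integral a hc hτ, schwartzFunction_integral a hc' hτ', funext h]

/-- The functional calculus is multiplicative. -/
theorem schwartzFunction_comp_eq (a : Fin m → ℝ) (g₁ g₂ k₁ k₂ : 𝓢(V m, ℂ)) (v : Hilb m)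
    (h : ∀ s, g₁ s * g₂ s = k₁ s * k₂ s) :
    schwartzFunction a g₁ (schwartzFunction a g₂ v)
      = schwartzFunction a k₁ (schwartzFunction a k₂ v) := by
  -- By Fourier inversion, the symbol of the integral of unitaries with weight `𝓕 g` is `g` itself.
  have key : ∀ (g : 𝓢(V m, ℂ)) (s : V m), ∫ p, (𝓕 g : 𝓢(V m, ℂ)) p *
      Complex.exp (2 * Real.pi * Complex.I * inner ℝ p s) = g s := by
    intro g s
    have h1 : (𝓕⁻ (𝓕 g) : 𝓢(V m, ℂ)) s = g s := by rw [FourierTransform.fourierInv_fourier_eq]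
    rw [← h1, SchwartzMap.fourierInv_coe, Real.fourierInv_eq']
    refine integral_congr_ae (Filter.Eventually.of_forall fun p => ?_)
    simp only [smul_eq_mul]
    rw [mul_comm]
    congr 2
    push_cast
    ring
  rw [schwartzFunction_eq a g₂, schwartzFunction_eq a k₂]
  refine schwartzFunction_integral_eq a (SchwartzMap.integrable _) measurable_id
    (SchwartzMap.integrable _) measurable_id _ _ v fun s => ?_
  simpa only [id, key] using h s

/-! ### Superexponential decay -/

/-- Decay faster than every exponential. -/
def SuperexpDecay {E : Type*} [Norm E] (f : E → ℂ) : Prop :=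
  ∀ c : ℝ, ∃ C : ℝ, ∀ z, ‖f z‖ ≤ C * Real.exp (-(c * ‖z‖))

theorem integrable_exp_neg_norm {E : Type*} [NormedAddCommGroup E] [NormedSpace ℝ E]
    [FiniteDimensional ℝ E] [MeasurableSpace E] [BorelSpace E] (μ : Measure E)
    [μ.IsAddHaarMeasure] : Integrable (fun x : E => Real.exp (-‖x‖)) μ := by
  -- The power `(1 + ‖x‖)^(-n)` is integrable once `n` exceeds the dimension. The constant `e · n!`
  -- comes from `t^n / n! ≤ e^t` at `t = 1 + ‖x‖`.
  set n := Module.finrank ℝ E + 1 with hn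
  have h := (integrable_one_add_norm (μ := μ) (E := E) (r := (n : ℝ))
    (by rw [hn]; push_cast; linarith)).const_mul (Real.exp 1 * n.factorial)
  refine h.mono' (by fun_prop) (Filter.Eventually.of_forall fun x => ?_)
  have h0 : 0 < 1 + ‖x‖ := by positivity
  have h1 := Real.pow_div_factorial_le_exp (1 + ‖x‖) h0.le n
  rw [Real.norm_of_nonneg (Real.exp_pos _).le, Real.rpow_neg h0.le, Real.rpow_natCast]
  rw [div_le_iff₀ (by positivity), Real.exp_add] at h1
  rw [Real.exp_neg, ← div_eq_mul_inv, le_div_iff₀ (by positivity), inv_mul_le_iff₀ (by positivity)]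
  linarith

/-- Decay at rate `K + 1` absorbs the growth `e^{K‖x‖}` and leaves `e^{-‖x‖}`. Every weight below is
integrated this way, since the dilations and `e^{k·x}` grow exponentially. -/
theorem SuperexpDecay.integrable_of_le {E F : Type*} [NormedAddCommGroup E] [NormedSpace ℝ E]
    [FiniteDimensional ℝ E] [MeasurableSpace E] [BorelSpace E] [NormedAddCommGroup F]
    {μ : Measure E} [μ.IsAddHaarMeasure] {f : E → ℂ} (hf : SuperexpDecay f) (K : ℝ) {g : E → F}
    (hg : AEStronglyMeasurable g μ) (h : ∀ x, ‖g x‖ ≤ Real.exp (K * ‖x‖) * ‖f x‖) :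
    Integrable g μ := by
  obtain ⟨C, hC⟩ := hf (K + 1)
  refine ((integrable_exp_neg_norm μ).const_mul C).mono' hg
    (Filter.Eventually.of_forall fun x => (h x).trans ?_)
  calc Real.exp (K * ‖x‖) * ‖f x‖
      ≤ Real.exp (K * ‖x‖) * (C * Real.exp (-((K + 1) * ‖x‖))) := by gcongr; exact hC x
    _ = C * (Real.exp (K * ‖x‖) * Real.exp (-((K + 1) * ‖x‖))) := by ring
    _ = C * Real.exp (-‖x‖) := by rw [← Real.exp_add]; congr 2; ring

theorem SuperexpDecay.integrable {E : Type*} [NormedAddCommGroup E] [NormedSpace ℝ E]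
    [FiniteDimensional ℝ E] [MeasurableSpace E] [BorelSpace E]
    {μ : Measure E} [μ.IsAddHaarMeasure] {f : E → ℂ} (hf : SuperexpDecay f)
    (hc : Continuous f) : Integrable f μ :=
  hf.integrable_of_le 0 hc.aestronglyMeasurable fun x => by simp

theorem SuperexpDecay.comp_smul {E : Type*} [NormedAddCommGroup E] [NormedSpace ℝ E]
    {f : E → ℂ} (hf : SuperexpDecay f) {r : ℝ} (hr : 0 < r) :
    SuperexpDecay fun x => f (r • x) := by
  intro c
  obtain ⟨C, hC⟩ := hf (c / r)
  refine ⟨C, fun z => (hC _).trans_eq ?_⟩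
  rw [norm_smul, Real.norm_of_nonneg hr.le]
  congr 3
  field_simp

/-! ### Cut-off functions and their Fourier transforms -/

/-- A cut-off function `χ` on `ℝ^m × ℝ^m` and its Fourier transform `ψ`. -/
structure CutoffPair (χ ψ : V m × V m → ℂ) : Prop where
  continuous_left : Continuous χ
  continuous_right : Continuous ψ
  decay_left : SuperexpDecay χ
  decay_right : SuperexpDecay ψ
  fourier_eq : ∀ z, ψ z = ∫ w : V m × V m,
    Complex.exp (-(2 * Real.pi * Complex.I * (inner ℝ w.1 z.1 + inner ℝ w.2 z.2 : ℝ))) * χ w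
  integral_eq : ∫ z, ψ z = 1

instance isAddHaarMeasure_volume_prod : (volume : Measure (V m × V m)).IsAddHaarMeasure :=
  inferInstanceAs ((volume : Measure (V m)).prod (volume : Measure (V m))).IsAddHaarMeasure

theorem integral_toLp (f : WithLp 2 (V m × V m) → ℂ) :
    ∫ z : V m × V m, f (WithLp.toLp 2 z) = ∫ z, f z :=
  (WithLp.volume_preserving_toLp (V m) (V m)).integral_comp
    (MeasurableEquiv.toLp 2 (V m × V m)).measurableEmbedding f

theorem SuperexpDecay.comp_toLp {f : WithLp 2 (V m × V m) → ℂ} (hf : SuperexpDecay f) :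
    SuperexpDecay fun z : V m × V m => f (WithLp.toLp 2 z) := by
  intro c
  -- The product carries the sup norm, which is at most the Euclidean one. The comparison of
  -- exponentials needs a nonnegative rate, hence `|c|`.
  obtain ⟨C, hC⟩ := hf |c|
  have hC0 : 0 ≤ C := by
    have := (norm_nonneg _).trans (hC 0)
    simpa using this
  refine ⟨C, fun z => (hC _).trans ?_⟩
  have h1 : ‖z‖ ≤ ‖(WithLp.toLp 2 z : WithLp 2 (V m × V m))‖ :=
    max_le (WithLp.norm_fst_le _ (WithLp.toLp 2 z)) (WithLp.norm_snd_le _ (WithLp.toLp 2 z))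
  gcongr
  exact le_abs_self c

theorem IsCutoff.cutoffPair {χ : 𝓢(WithLp 2 (V m × V m), ℂ)} (hχ : IsCutoff χ) :
    CutoffPair (fun z => χ (WithLp.toLp 2 z))
      (fun z => (𝓕 χ : 𝓢(WithLp 2 (V m × V m), ℂ)) (WithLp.toLp 2 z)) where
  continuous_left := χ.continuous.comp (WithLp.prod_continuous_toLp 2 _ _)
  continuous_right := (𝓕 χ : 𝓢(WithLp 2 (V m × V m), ℂ)).continuous.comp
    (WithLp.prod_continuous_toLp 2 _ _)
  decay_left := SuperexpDecay.comp_toLp hχ.2.1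
  decay_right := SuperexpDecay.comp_toLp hχ.2.2
  fourier_eq z := by
    rw [SchwartzMap.fourier_coe, Real.fourier_eq', ← integral_toLp]
    refine integral_congr_ae (Filter.Eventually.of_forall fun w => ?_)
    simp only [WithLp.prod_inner_apply, smul_eq_mul]
    congr 2
    push_cast
    ring
  integral_eq := by
    rw [integral_toLp]
    have h : (𝓕⁻ (𝓕 χ) : 𝓢(WithLp 2 (V m × V m), ℂ)) 0 = χ 0 := by
      rw [FourierTransform.fourierInv_fourier_eq]
    rw [SchwartzMap.fourierInv_coe, Real.fourierInv_eq', hχ.1] at h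
    simpa using h

theorem norm_cexp_two_pi (t : ℝ) :
    ‖Complex.exp (2 * Real.pi * Complex.I * t)‖ = 1 := by
  have : (2 * Real.pi * Complex.I * t : ℂ) = ((2 * Real.pi * t : ℝ) : ℂ) * Complex.I := by
    push_cast; ring
  rw [this, Complex.norm_exp_ofReal_mul_I]

theorem norm_cexp_neg_two_pi (t : ℝ) :
    ‖Complex.exp (-(2 * Real.pi * Complex.I * t))‖ = 1 := by
  rw [Complex.exp_neg, norm_inv, norm_cexp_two_pi, inv_one]

namespace CutoffPair

variable {χ ψ : V m × V m → ℂ}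

theorem integrable_mul_phase (h : CutoffPair χ ψ) (η : V m) :
    Integrable fun w : V m × V m =>
      Complex.exp (-(2 * Real.pi * Complex.I * (inner ℝ w.2 η : ℝ))) * χ w := by
  refine h.decay_left.integrable_of_le 0 ?_ fun w => ?_
  · have := h.continuous_left
    exact Continuous.aestronglyMeasurable (by fun_prop)
  · rw [norm_mul, norm_cexp_neg_two_pi]; simp

/-- Fourier inversion in the first variable. -/
theorem integral_snd_eq (h : CutoffPair χ ψ) (x η : V m) :
    ∫ y, Complex.exp (-(2 * Real.pi * Complex.I * (inner ℝ y η : ℝ))) * χ (x, y)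
      = ∫ ξ, Complex.exp (2 * Real.pi * Complex.I * (inner ℝ ξ x : ℝ)) * ψ (ξ, η) := by
  set f : V m → ℂ := fun x =>
    ∫ y, Complex.exp (-(2 * Real.pi * Complex.I * (inner ℝ y η : ℝ))) * χ (x, y) with hf
  have hχ := h.continuous_left
  have hfc : Continuous f := by
    obtain ⟨C, hC⟩ := h.decay_left 1
    refine continuous_of_dominated (bound := fun y => C * Real.exp (-‖y‖)) (fun x => ?_)
      (fun x => Filter.Eventually.of_forall fun y => ?_)
      ((integrable_exp_neg_norm _).const_mul C) (Filter.Eventually.of_forall fun y => ?_)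
    · exact Continuous.aestronglyMeasurable (by fun_prop)
    · rw [norm_mul, norm_cexp_neg_two_pi, one_mul]
      have hC0 : 0 ≤ C := by
        have := (norm_nonneg _).trans (hC 0)
        simpa using this
      refine (hC _).trans ?_
      rw [one_mul]
      gcongr
      exact norm_snd_le (x, y)
    · fun_prop
  have hfi : Integrable f := (h.integrable_mul_phase η).integral_prod_left
  -- Transforming the partial transform `f` in the remaining variable gives the full transform. As
  -- `f` is continuous and integrable with integrable transform, inversion holds at every point.
  have hF : 𝓕 f = fun ξ => ψ (ξ, η) := by
    funext ξ
    have hi : Integrable (fun w : V m × V m => Complex.exp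
        (-(2 * Real.pi * Complex.I * (inner ℝ w.1 ξ + inner ℝ w.2 η : ℝ))) * χ w)
        (volume.prod volume) := by
      refine h.decay_left.integrable_of_le 0 ?_ fun w => ?_
      · exact Continuous.aestronglyMeasurable (by fun_prop)
      · rw [norm_mul, norm_cexp_neg_two_pi]; simp
    rw [h.fourier_eq, Real.fourier_eq', Measure.volume_eq_prod, integral_prod _ hi]
    refine integral_congr_ae (Filter.Eventually.of_forall fun x => ?_)
    simp only [hf, smul_eq_mul]
    rw [← integral_const_mul]
    refine integral_congr_ae (Filter.Eventually.of_forall fun y => ?_)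
    simp only
    rw [← mul_assoc, ← Complex.exp_add]
    congr 2
    push_cast
    ring
  have hψi : Integrable fun ξ => ψ (ξ, η) := by
    obtain ⟨C, hC⟩ := h.decay_right 1
    have hψ := h.continuous_right
    have hC0 : 0 ≤ C := by
      have := (norm_nonneg _).trans (hC 0)
      simpa using this
    refine ((integrable_exp_neg_norm _).const_mul C).mono'
      (Continuous.aestronglyMeasurable (by fun_prop)) (Filter.Eventually.of_forall fun ξ => ?_)
    refine (hC _).trans ?_
    rw [one_mul]
    gcongr
    exact norm_fst_le (ξ, η)
  have hinv := congrFun (hfc.fourierInv_fourier_eq hfi (by rw [hF]; exact hψi)) x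
  refine hinv.symm.trans ?_
  rw [hF, Real.fourierInv_eq']
  refine integral_congr_ae (Filter.Eventually.of_forall fun ξ => ?_)
  simp only [smul_eq_mul]
  congr 2
  push_cast
  ring

end CutoffPair

/-! ### The regularized integrals -/

/-- The weight of `U(y)` in the regularized warped convolution integral. -/
def warpWeight (k : V m) (χ : V m × V m → ℂ) (ε : ℝ) (z : V m × V m) : ℂ :=
  (((2 * Real.pi) ^ m)⁻¹ : ℝ) * (χ (ε • z) * Complex.exp (-(Complex.I * (inner ℝ z.1 z.2 : ℝ)))
    * Real.exp (inner ℝ k z.1))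

/-- The weight of `exp(2πi ε ξ·X)` in the regularizing operator. -/
def regWeight (k : V m) (ψ : V m × V m → ℂ) (ε : ℝ) (z : V m × V m) : ℂ :=
  ψ z * Complex.exp (2 * Real.pi * Complex.I * (2 * Real.pi * ε ^ 2 * inner ℝ z.1 z.2 : ℝ))
    * Real.exp (2 * Real.pi * ε * inner ℝ k z.2)

theorem norm_real_exp (t : ℝ) : ‖((Real.exp t : ℝ) : ℂ)‖ = Real.exp t := by
  rw [Complex.norm_real, Real.norm_of_nonneg (Real.exp_pos _).le]

/-- The factor `e^{k·x}` grows exponentially, and the decay of the cut-off compensates for it. -/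
theorem integrable_warpWeight (k : V m) {χ : V m × V m → ℂ} (hc : Continuous χ)
    (hd : SuperexpDecay χ) {ε : ℝ} (hε : 0 < ε) : Integrable (warpWeight k χ ε) := by
  refine Integrable.const_mul ?_ _
  refine (hd.comp_smul hε).integrable_of_le ‖k‖ ?_ fun z => ?_
  · exact Continuous.aestronglyMeasurable (by fun_prop)
  · have : ‖Complex.exp (-(Complex.I * (inner ℝ z.1 z.2 : ℝ)))‖ = 1 := by
      rw [Complex.exp_neg, mul_comm, norm_inv, Complex.norm_exp_ofReal_mul_I, inv_one]
    rw [norm_mul, norm_mul, this, norm_real_exp, mul_one, mul_comm ‖χ (ε • z)‖]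
    gcongr
    exact (real_inner_le_norm _ _).trans (by gcongr; exact norm_fst_le z)

/-- The bound does not depend on `ε`, so it serves as the dominating function in `tendsto_reg`. -/
theorem norm_regWeight_le (k : V m) (ψ : V m × V m → ℂ) {ε : ℝ} (h0 : 0 ≤ ε) (h1 : ε ≤ 1)
    (z : V m × V m) : ‖regWeight k ψ ε z‖ ≤ Real.exp ((2 * Real.pi * ‖k‖) * ‖z‖) * ‖ψ z‖ := by
  rw [regWeight, norm_mul, norm_mul, norm_cexp_two_pi, norm_real_exp, mul_one,
    mul_comm ‖ψ z‖]
  refine mul_le_mul_of_nonneg_right (Real.exp_le_exp.2 ?_) (norm_nonneg _)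
  have h2 : inner ℝ k z.2 ≤ ‖k‖ * ‖z‖ :=
    (real_inner_le_norm _ _).trans (by gcongr; exact norm_snd_le z)
  have hp := Real.pi_pos
  calc 2 * Real.pi * ε * inner ℝ k z.2 ≤ 2 * Real.pi * ε * (‖k‖ * ‖z‖) := by gcongr
    _ ≤ 2 * Real.pi * 1 * (‖k‖ * ‖z‖) := by gcongr
    _ = _ := by ring

theorem continuous_regWeight (k : V m) {ψ : V m × V m → ℂ} (hc : Continuous ψ) (ε : ℝ) :
    Continuous (regWeight k ψ ε) := by
  unfold regWeight
  fun_prop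

theorem integrable_regWeight (k : V m) {ψ : V m × V m → ℂ} (hc : Continuous ψ)
    (hd : SuperexpDecay ψ) {ε : ℝ} (h0 : 0 ≤ ε) (h1 : ε ≤ 1) : Integrable (regWeight k ψ ε) :=
  hd.integrable_of_le _ (continuous_regWeight k hc ε).aestronglyMeasurable
    (norm_regWeight_le k ψ h0 h1)

/-! ### Classes of Schwartz functions, Gaussians -/

/-- Fixed continuous linear maps composed with the partial derivatives: in this form smoothness and
bounds on iterated derivatives pass from the partial derivatives to `fderiv`. -/
theorem fderiv_eq_sum_basis {ι E : Type*} [Fintype ι] [NormedAddCommGroup E] [NormedSpace ℝ E]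
    [FiniteDimensional ℝ E] (b : Module.Basis ι ℝ E) (f : E → ℂ) :
    fderiv ℝ f = fun x => ∑ j, (ContinuousLinearMap.smulRightL ℝ E ℂ
      (LinearMap.toContinuousLinearMap (b.coord j)) ∘ fun x => fderiv ℝ f x (b j)) x := by
  funext x
  ext v
  conv_lhs => rw [← b.sum_repr v, map_sum]
  simp

/-- A class of rapidly decreasing differentiable functions that is closed under partial derivatives
consists of Schwartz functions. -/
theorem exists_schwartzMap_of_closed {ι E : Type*} [Fintype ι] [NormedAddCommGroup E]
    [NormedSpace ℝ E] [FiniteDimensional ℝ E] (b : Module.Basis ι ℝ E) {S : (E → ℂ) → Prop}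
    (hdecay : ∀ f, S f → ∀ k : ℕ, ∃ C : ℝ, ∀ x, ‖x‖ ^ k * ‖f x‖ ≤ C)
    (hdiff : ∀ f, S f → Differentiable ℝ f)
    (hderiv : ∀ f, S f → ∀ j, S fun x => fderiv ℝ f x (b j)) (f : E → ℂ) (hf : S f) :
    ∃ φ : 𝓢(E, ℂ), ∀ x, φ x = f x := by
  let L : ι → (ℂ →L[ℝ] (E →L[ℝ] ℂ)) := fun j =>
    ContinuousLinearMap.smulRightL ℝ E ℂ (LinearMap.toContinuousLinearMap (b.coord j))
  -- The induction runs over all members of the class at once, because its step applies the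
  -- hypothesis to the partial derivatives. The same holds for `hbound`.
  have hn : ∀ (n : ℕ) (f : E → ℂ), S f → ContDiff ℝ n f := by
    intro n
    induction n with
    | zero => exact fun f hf => contDiff_zero.2 (hdiff f hf).continuous
    | succ n ih =>
      intro f hf
      push_cast
      refine contDiff_succ_iff_fderiv.2 ⟨hdiff f hf, fun h => by simp at h, ?_⟩
      rw [fderiv_eq_sum_basis b f]
      exact ContDiff.sum fun j _ => (L j).contDiff.comp (ih _ (hderiv f hf j))
  have hsmooth : ∀ f, S f → ContDiff ℝ ∞ f := fun f hf =>
    contDiff_infty.2 fun n => hn n f hf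
  have hbound : ∀ (n : ℕ) (f : E → ℂ), S f → ∀ k : ℕ, ∃ C : ℝ, ∀ x,
      ‖x‖ ^ k * ‖iteratedFDeriv ℝ n f x‖ ≤ C := by
    intro n
    induction n with
    | zero => simpa only [norm_iteratedFDeriv_zero] using hdecay
    | succ n ih =>
      intro f hf k
      choose C hC using fun j => ih _ (hderiv f hf j) k
      refine ⟨∑ j, ‖L j‖ * C j, fun x => ?_⟩
      have hcd : ∀ j, ContDiff ℝ ∞ fun x => fderiv ℝ f x (b j) := fun j =>
        hsmooth _ (hderiv f hf j)
      have hcL : ∀ j, ContDiff ℝ ∞ (L j ∘ fun x => fderiv ℝ f x (b j)) := fun j =>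
        (L j).contDiff.comp (hcd j)
      rw [← norm_iteratedFDeriv_fderiv, fderiv_eq_sum_basis b f,
        iteratedFDeriv_fun_sum_apply (fun j _ =>
          ((hcL j).of_le (by exact_mod_cast le_top)).contDiffAt)]
      refine (mul_le_mul_of_nonneg_left (norm_sum_le _ _) (by positivity)).trans ?_
      rw [Finset.mul_sum]
      refine Finset.sum_le_sum fun j _ => ?_
      calc ‖x‖ ^ k * ‖iteratedFDeriv ℝ n (L j ∘ fun x => fderiv ℝ f x (b j)) x‖
          ≤ ‖x‖ ^ k * (‖L j‖ * ‖iteratedFDeriv ℝ n (fun x => fderiv ℝ f x (b j)) x‖) := by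
            gcongr
            exact (L j).norm_iteratedFDeriv_comp_left (hcd j).contDiffAt
              (by exact_mod_cast le_top)
        _ = ‖L j‖ * (‖x‖ ^ k * ‖iteratedFDeriv ℝ n (fun x => fderiv ℝ f x (b j)) x‖) := by ring
        _ ≤ ‖L j‖ * C j := by gcongr; exact hC j x
  exact ⟨⟨f, hsmooth f hf, fun k n => hbound n f hf k⟩, fun x => rfl⟩

theorem hasTemperateGrowth_fderiv_apply {E : Type*} [NormedAddCommGroup E] [NormedSpace ℝ E]
    {P : E → ℂ} (hP : P.HasTemperateGrowth) (v : E) :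
    (fun x => fderiv ℝ P x v).HasTemperateGrowth := by
  have h : (fderiv ℝ P).HasTemperateGrowth := by
    refine ⟨hP.1.fderiv_right (by simp), fun n => ?_⟩
    obtain ⟨k, C, h⟩ := hP.2 (n + 1)
    exact ⟨k, C, fun x => by rw [norm_iteratedFDeriv_fderiv]; exact h x⟩
  exact (ContinuousLinearMap.hasTemperateGrowth (ContinuousLinearMap.apply ℝ ℂ v)).comp h

section Gaussian

variable {E : Type*} [NormedAddCommGroup E] [InnerProductSpace ℝ E]

/-- The Gaussian `exp(-b |x|² + ℓ(x))`. -/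
def gaussFun (b : ℝ) (ℓ : E →L[ℝ] ℂ) (x : E) : ℂ := Complex.exp (-b * (‖x‖ ^ 2 : ℝ) + ℓ x)

theorem norm_gaussFun_le (b : ℝ) (ℓ : E →L[ℝ] ℂ) (x : E) :
    ‖gaussFun b ℓ x‖ ≤ Real.exp (-b * ‖x‖ ^ 2 + ‖ℓ‖ * ‖x‖) := by
  rw [gaussFun, Complex.norm_exp]
  have h : (ℓ x).re ≤ ‖ℓ‖ * ‖x‖ := (Complex.re_le_norm _).trans (ℓ.le_opNorm x)
  rw [Complex.add_re, ← Complex.ofReal_neg, ← Complex.ofReal_mul, Complex.ofReal_re]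
  gcongr

theorem neg_sq_add_le {b : ℝ} (hb : 0 < b) (K r : ℝ) : -b * r ^ 2 + K * r ≤ K ^ 2 / (4 * b) := by
  rw [le_div_iff₀ (by positivity)]
  nlinarith [sq_nonneg (2 * b * r - K)]

theorem superexpDecay_gaussFun {b : ℝ} (hb : 0 < b) (ℓ : E →L[ℝ] ℂ) :
    SuperexpDecay (gaussFun b ℓ) := by
  intro c
  -- The exponent is the maximum over `r` of `-b r² + (‖ℓ‖ + c) r`.
  refine ⟨Real.exp ((‖ℓ‖ + c) ^ 2 / (4 * b)), fun x => (norm_gaussFun_le b ℓ x).trans ?_⟩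
  rw [← Real.exp_add]
  refine Real.exp_le_exp.2 ?_
  have := neg_sq_add_le hb (‖ℓ‖ + c) ‖x‖
  linarith

theorem SuperexpDecay.pow_mul_bound {E : Type*} [NormedAddCommGroup E] {f : E → ℂ}
    (hf : SuperexpDecay f) (k : ℕ) : ∃ C : ℝ, ∀ x, (1 + ‖x‖) ^ k * ‖f x‖ ≤ C := by
  obtain ⟨C, hC⟩ := hf 1
  refine ⟨k.factorial * Real.exp 1 * C, fun x => ?_⟩
  have h1 := Real.pow_div_factorial_le_exp (1 + ‖x‖) (by positivity) k
  rw [div_le_iff₀ (by positivity)] at h1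
  calc (1 + ‖x‖) ^ k * ‖f x‖
      ≤ (Real.exp (1 + ‖x‖) * k.factorial) * (C * Real.exp (-(1 * ‖x‖))) := by
        gcongr; exact hC x
    _ = k.factorial * C * (Real.exp (1 + ‖x‖) * Real.exp (-(1 * ‖x‖))) := by ring
    _ = k.factorial * Real.exp 1 * C := by
        rw [← Real.exp_add]; ring_nf

theorem exists_schwartzMap_gaussFun [FiniteDimensional ℝ E] {b : ℝ} (hb : 0 < b)
    (ℓ : E →L[ℝ] ℂ) : ∃ φ : 𝓢(E, ℂ), ∀ x, φ x = gaussFun b ℓ x := by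
  have hder : ∀ x, HasFDerivAt (gaussFun b ℓ)
      (gaussFun b ℓ x • ((-b : ℂ) • (Complex.ofRealCLM.comp (2 • innerSL ℝ x)) + ℓ)) x := by
    intro x
    have h1 : HasFDerivAt (fun x : E => ‖x‖ ^ 2) (2 • innerSL ℝ x) x :=
      (hasStrictFDerivAt_norm_sq x).hasFDerivAt
    have h2 : HasFDerivAt (fun x : E => ((‖x‖ ^ 2 : ℝ) : ℂ))
      (Complex.ofRealCLM.comp (2 • innerSL ℝ x)) x := Complex.ofRealCLM.hasFDerivAt.comp x h1
    exact ((h2.const_mul (-b : ℂ)).add ℓ.hasFDerivAt).cexp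
  -- The Gaussian alone is not stable under derivatives, but its products with functions of
  -- temperate growth are.
  refine exists_schwartzMap_of_closed (Module.finBasis ℝ E)
    (S := fun f => ∃ P : E → ℂ, P.HasTemperateGrowth ∧ f = fun x => P x * gaussFun b ℓ x)
    ?_ ?_ ?_ _ ⟨fun _ => 1, .const 1, by simp⟩
  · rintro f ⟨P, hP, rfl⟩ k
    obtain ⟨N, C, h⟩ := hP.2 0
    obtain ⟨D, hD⟩ := (superexpDecay_gaussFun hb ℓ).pow_mul_bound (k + N)
    refine ⟨|C| * D, fun x => ?_⟩
    have h0 := h x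
    rw [norm_iteratedFDeriv_zero] at h0
    rw [norm_mul]
    calc ‖x‖ ^ k * (‖P x‖ * ‖gaussFun b ℓ x‖)
        ≤ (1 + ‖x‖) ^ k * ((|C| * (1 + ‖x‖) ^ N) * ‖gaussFun b ℓ x‖) := by
          gcongr
          · linarith
          · refine h0.trans ?_
            gcongr
            exact le_abs_self C
      _ = |C| * ((1 + ‖x‖) ^ (k + N) * ‖gaussFun b ℓ x‖) := by ring
      _ ≤ |C| * D := by gcongr; exact hD x
  · rintro f ⟨P, hP, rfl⟩ x
    exact ((hP.1.differentiable (by simp)) x).mul (hder x).differentiableAt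
  · rintro f ⟨P, hP, rfl⟩ j
    set v := Module.finBasis ℝ E j
    refine ⟨fun x => fderiv ℝ P x v + P x * (-b * (2 * inner ℝ x v : ℝ) + ℓ v), ?_, ?_⟩
    · refine (hasTemperateGrowth_fderiv_apply hP v).add (hP.mul (.add (.mul (.const _) ?_)
        (.const _)))
      have : (fun x : E => ((2 * inner ℝ x v : ℝ) : ℂ))
          = ((2 : ℝ) • Complex.ofRealCLM.comp (innerSL ℝ v) : E →L[ℝ] ℂ) := by
        funext x
        simp [real_inner_comm]
      rw [this]
      exact ContinuousLinearMap.hasTemperateGrowth _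
    · funext x
      have h1 := ((hP.1.differentiable (by simp)) x).hasFDerivAt.mul (hder x)
      erw [h1.fderiv]
      simp
      ring

/-- The Gaussian `exp(-b |x|² + ℓ(x))` as a Schwartz function. -/
def gaussS [FiniteDimensional ℝ E] {b : ℝ} (hb : 0 < b) (ℓ : E →L[ℝ] ℂ) : 𝓢(E, ℂ) :=
  (exists_schwartzMap_gaussFun hb ℓ).choose

theorem gaussS_apply [FiniteDimensional ℝ E] {b : ℝ} (hb : 0 < b) (ℓ : E →L[ℝ] ℂ) (x : E) :
    gaussS hb ℓ x = gaussFun b ℓ x :=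
  (exists_schwartzMap_gaussFun hb ℓ).choose_spec x

end Gaussian

/-- Gaussians are cut-off functions. -/
theorem exists_isCutoff : ∃ χ : 𝓢(WithLp 2 (V m × V m), ℂ), IsCutoff χ := by
  -- With `b = π` the Gaussian is its own Fourier transform, so one decay estimate settles both
  -- conditions.
  refine ⟨gaussS Real.pi_pos 0, ?_, ?_, ?_⟩
  · simp [gaussS_apply, gaussFun]
  · intro c
    simpa only [gaussS_apply] using superexpDecay_gaussFun Real.pi_pos 0 c
  · intro c
    obtain ⟨C, hC⟩ := superexpDecay_gaussFun (E := WithLp 2 (V m × V m)) Real.pi_pos 0 c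
    refine ⟨C, fun z => ?_⟩
    convert hC z using 2
    rw [SchwartzMap.fourier_coe]
    have h1 : (gaussS Real.pi_pos 0 : WithLp 2 (V m × V m) → ℂ)
        = fun v => Complex.exp (-(Real.pi : ℂ) * ‖v‖ ^ 2) := by
      funext v
      simp [gaussS_apply, gaussFun]
    rw [h1, fourier_gaussian_innerProductSpace (by simpa using Real.pi_pos)]
    have hpi : (Real.pi : ℂ) ≠ 0 := by exact_mod_cast Real.pi_ne_zero
    rw [div_self hpi, Complex.one_cpow, one_mul, gaussFun]
    congr 1
    simp only [zero_apply, add_zero]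
    push_cast
    field_simp

/-- The linear form `x ↦ ∑ z_j x_j`. -/
def linForm (z : Fin m → ℂ) : V m →L[ℝ] ℂ :=
  ∑ j, (EuclideanSpace.proj j : V m →L[ℝ] ℝ).smulRight (z j)

theorem linForm_apply (z : Fin m → ℂ) (x : V m) : linForm z x = ∑ j, z j * x j := by
  simp [linForm, mul_comm]

/-- This is the Gaussian integral with linear coefficients `z_j - 2πi p_j`, after expanding their
squares. Complex `z` is allowed because `derivWeight_fourier_gaussS` uses an imaginary one. -/
theorem fourier_gaussS {b : ℝ} (hb : 0 < b) (z : Fin m → ℂ) (p : V m) :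
    (𝓕 (gaussS hb (linForm z)) : 𝓢(V m, ℂ)) p
      = (Real.pi / b : ℂ) ^ (m / 2 : ℂ) * Complex.exp ((∑ j, z j ^ 2) / (4 * b)) *
        gaussFun (Real.pi ^ 2 / b) (linForm fun j => -(Complex.I * Real.pi / b) * z j) p := by
  rw [SchwartzMap.fourier_coe, Real.fourier_eq', ← (PiLp.volume_preserving_toLp (Fin m)).integral_comp
    (MeasurableEquiv.toLp 2 _).measurableEmbedding]
  have h := GaussianFourier.integral_cexp_neg_mul_sum_add (b := (b : ℂ)) (by simpa using hb)
    (fun j : Fin m => z j - 2 * Real.pi * Complex.I * p j)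
  rw [Fintype.card_fin] at h
  rw [mul_assoc, gaussFun, ← Complex.exp_add]
  refine (integral_congr_ae (Filter.Eventually.of_forall fun v => ?_)).trans (h.trans ?_)
  · simp only [smul_eq_mul, gaussS_apply, gaussFun, linForm_apply]
    rw [← Complex.exp_add, EuclideanSpace.norm_sq_eq, PiLp.inner_apply]
    congr 1
    push_cast
    simp only [Finset.mul_sum, Finset.sum_mul, ← Finset.sum_add_distrib]
    refine Finset.sum_congr rfl fun j _ => ?_
    have h2 : ((‖v j‖ : ℝ) : ℂ) ^ 2 = (v j : ℂ) ^ 2 := by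
      rw [← Complex.ofReal_pow, Real.norm_eq_abs, sq_abs, Complex.ofReal_pow]
    rw [h2]
    simp
    ring
  · congr 2
    have hb' : (b : ℂ) ≠ 0 := by exact_mod_cast hb.ne'
    rw [linForm_apply, EuclideanSpace.norm_sq_eq]
    push_cast
    simp only [Finset.mul_sum, Finset.sum_div, ← Finset.sum_add_distrib]
    refine Finset.sum_congr rfl fun j _ => ?_
    have h2 : ((‖p j‖ : ℝ) : ℂ) ^ 2 = (p j : ℂ) ^ 2 := by
      rw [← Complex.ofReal_pow, Real.norm_eq_abs, sq_abs, Complex.ofReal_pow]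
    rw [h2]
    field_simp
    ring_nf
    simp
    ring

/-! ### Warped convolution and functional calculus -/

theorem integrable_mul_cexp_two_pi {Z : Type*} [MeasurableSpace Z] {ν : Measure Z} {f : Z → ℂ}
    (hf : Integrable f ν) {t : Z → ℝ} (ht : Measurable t) :
    Integrable (fun z => f z * Complex.exp (2 * Real.pi * Complex.I * t z)) ν := by
  refine hf.norm.mono' (hf.aestronglyMeasurable.mul ?_) (Filter.Eventually.of_forall fun z => ?_)
  · exact Measurable.aestronglyMeasurable (by fun_prop)
  · rw [norm_mul, norm_cexp_two_pi, mul_one]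

/-- The function of `X` given by the regularized warped convolution integral. -/
theorem integral_warpWeight {χ ψ : V m × V m → ℂ} (h : CutoffPair χ ψ) (k s : V m) {ε : ℝ}
    (hε : 0 < ε) (hε1 : ε ≤ 1) :
    ∫ z, warpWeight k χ ε z * Complex.exp (2 * Real.pi * Complex.I *
        (inner ℝ ((2 * Real.pi)⁻¹ • z.2) s : ℝ))
      = Real.exp (inner ℝ k s) * ∫ z, regWeight k ψ ε z *
        Complex.exp (2 * Real.pi * Complex.I * (inner ℝ (ε • z.1) s : ℝ)) := by
  have hπ := Real.pi_pos
  set H : V m → V m → ℂ := fun x η =>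
    ∫ y, Complex.exp (-(2 * Real.pi * Complex.I * (inner ℝ y η : ℝ))) * χ (x, y) with hH
  set Q : V m → ℂ := fun η => Real.exp (inner ℝ k (s + (2 * Real.pi * ε) • η)) *
    H (ε • (s + (2 * Real.pi * ε) • η)) η with hQ
  have hL : ∫ z, warpWeight k χ ε z * Complex.exp (2 * Real.pi * Complex.I *
        (inner ℝ ((2 * Real.pi)⁻¹ • z.2) s : ℝ)) = ∫ η, Q η := by
    have hi : Integrable (fun z : V m × V m => warpWeight k χ ε z * Complex.exp (2 * Real.pi *
        Complex.I * (inner ℝ ((2 * Real.pi)⁻¹ • z.2) s : ℝ))) (volume.prod volume) :=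
      integrable_mul_cexp_two_pi (integrable_warpWeight k h.continuous_left h.decay_left hε)
        (t := fun z : V m × V m => inner ℝ ((2 * Real.pi)⁻¹ • z.2) s) (by fun_prop)
    rw [Measure.volume_eq_prod, integral_prod _ hi]
    -- Rescaling `y` by `ε` gives a partial Fourier transform of `χ` at frequency `η = (x -
    -- s)/(2πε)`. Integrating over `η` instead of `x` then produces `(2πε)^m`, which cancels the
    -- prefactors.
    have hinner : ∀ x, ∫ y, warpWeight k χ ε (x, y) * Complex.exp (2 * Real.pi * Complex.I *
        (inner ℝ ((2 * Real.pi)⁻¹ • y) s : ℝ))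
        = (((2 * Real.pi) ^ m)⁻¹ * (ε ^ m)⁻¹ : ℝ) * Q ((2 * Real.pi * ε)⁻¹ • (x - s)) := by
      intro x
      have hx : s + (2 * Real.pi * ε) • ((2 * Real.pi * ε)⁻¹ • (x - s)) = x := by
        rw [smul_inv_smul₀ (by positivity)]
        abel
      set η := (2 * Real.pi * ε)⁻¹ • (x - s) with hη
      have h1 := Measure.integral_comp_smul (volume : Measure (V m))
        (fun y => Complex.exp (-(2 * Real.pi * Complex.I * (inner ℝ y η : ℝ))) * χ (ε • x, y)) ε
      rw [finrank_euclideanSpace_fin, abs_of_pos (by positivity), Complex.real_smul] at h1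
      simp only [hQ, hx]
      rw [hH]
      simp only
      push_cast at h1 ⊢
      rw [mul_left_comm, mul_assoc (((2 * (Real.pi : ℂ)) ^ m)⁻¹), ← h1, ← mul_assoc,
        ← integral_const_mul]
      refine integral_congr_ae (Filter.Eventually.of_forall fun y => ?_)
      have hphase : Complex.exp (-(Complex.I * (inner ℝ x y : ℝ))) * Complex.exp
          (2 * Real.pi * Complex.I * (inner ℝ ((2 * Real.pi)⁻¹ • y) s : ℝ))
          = Complex.exp (-(2 * Real.pi * Complex.I * (inner ℝ (ε • y) η : ℝ))) := by
        rw [← Complex.exp_add]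
        congr 1
        rw [hη]
        simp only [inner_smul_left, inner_smul_right, inner_sub_right, real_inner_comm x y]
        have hπ' : (Real.pi : ℂ) ≠ 0 := by exact_mod_cast hπ.ne'
        have hε' : (ε : ℂ) ≠ 0 := by exact_mod_cast hε.ne'
        simp
        field_simp
        ring
      simp only [warpWeight, Prod.smul_mk]
      rw [← hphase]
      push_cast
      ring
    simp only [hinner]
    rw [integral_const_mul, integral_sub_right_eq_self (fun x => Q ((2 * Real.pi * ε)⁻¹ • x)) s,
      Measure.integral_comp_smul, finrank_euclideanSpace_fin, abs_of_pos (by positivity),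
      Complex.real_smul, ← mul_assoc, ← Complex.ofReal_mul]
    have : (((2 * Real.pi) ^ m)⁻¹ * (ε ^ m)⁻¹) * ((((2 * Real.pi * ε)⁻¹) ^ m)⁻¹) = 1 := by
      rw [inv_pow, inv_inv, mul_pow _ ε]
      field_simp
    rw [this]
    simp
  have hR : ∫ z, regWeight k ψ ε z *
        Complex.exp (2 * Real.pi * Complex.I * (inner ℝ (ε • z.1) s : ℝ))
      = ∫ η, ∫ ξ, regWeight k ψ ε (ξ, η) *
        Complex.exp (2 * Real.pi * Complex.I * (inner ℝ (ε • ξ) s : ℝ)) := by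
    refine integral_prod_symm _ ?_
    exact integrable_mul_cexp_two_pi (integrable_regWeight k h.continuous_right h.decay_right
      hε.le hε1) (t := fun z : V m × V m => inner ℝ (ε • z.1) s) (by fun_prop)
  rw [hL, hR, ← integral_const_mul]
  refine integral_congr_ae (Filter.Eventually.of_forall fun η => ?_)
  simp only [hQ, hH]
  -- Inversion at the point `ε(s + 2πε η)`: its first part gives the character of `s`, its second
  -- the phase with `ε²` in `regWeight`.
  rw [h.integral_snd_eq, ← integral_const_mul, ← integral_const_mul]
  refine integral_congr_ae (Filter.Eventually.of_forall fun ξ => ?_)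
  simp only [regWeight]
  have h1 : Real.exp (inner ℝ k (s + (2 * Real.pi * ε) • η))
      = Real.exp (inner ℝ k s) * Real.exp (2 * Real.pi * ε * inner ℝ k η) := by
    rw [← Real.exp_add, inner_add_right, inner_smul_right]
  have h2 : Complex.exp (2 * Real.pi * Complex.I *
        (inner ℝ ξ (ε • (s + (2 * Real.pi * ε) • η)) : ℝ))
      = Complex.exp (2 * Real.pi * Complex.I * (2 * Real.pi * ε ^ 2 * inner ℝ ξ η : ℝ))
        * Complex.exp (2 * Real.pi * Complex.I * (inner ℝ (ε • ξ) s : ℝ)) := by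
    rw [← Complex.exp_add]
    congr 1
    simp only [inner_smul_left, inner_smul_right, inner_add_right]
    simp
    ring
  rw [h1, h2]
  push_cast
  ring

/-- `g(X)` maps the regularized warped convolution to `(e^k g)(X)` of the regularized vector. -/
theorem schwartzFunction_warp {χ ψ : V m × V m → ℂ} (h : CutoffPair χ ψ) (a : Fin m → ℝ) (k : V m)
    {ε : ℝ} (hε : 0 < ε) (hε1 : ε ≤ 1) (g l : 𝓢(V m, ℂ))
    (hl : ∀ x, l x = Real.exp (inner ℝ k x) * g x) (v : Hilb m) :
    schwartzFunction a g (∫ z, warpWeight k χ ε z • phaseOp a ((2 * Real.pi)⁻¹ • z.2) v)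
      = schwartzFunction a l (∫ z, regWeight k ψ ε z • phaseOp a (ε • z.1) v) := by
  refine schwartzFunction_integral_eq a
    (integrable_warpWeight k h.continuous_left h.decay_left hε)
    (τ := fun z : V m × V m => (2 * Real.pi)⁻¹ • z.2) (by fun_prop)
    (integrable_regWeight k h.continuous_right h.decay_right hε.le hε1)
    (τ' := fun z : V m × V m => ε • z.1) (by fun_prop) g l v fun s => ?_
  rw [integral_warpWeight h k s hε hε1, hl]
  ring

theorem eventually_le_one : ∀ᶠ ε : ℝ in 𝓝[>] 0, 0 < ε ∧ ε ≤ 1 := by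
  filter_upwards [Ioc_mem_nhdsGT (show (0 : ℝ) < 1 by norm_num)] with ε hε using hε

/-- The regularizing operators converge strongly to the identity. -/
theorem tendsto_reg {χ ψ : V m × V m → ℂ} (h : CutoffPair χ ψ) (a : Fin m → ℝ) (k : V m)
    (w : Hilb m) :
    Filter.Tendsto (fun ε : ℝ => ∫ z, regWeight k ψ ε z • phaseOp a (ε • z.1) w)
      (𝓝[>] 0) (𝓝 w) := by
  have hψ := h.continuous_right
  -- At `ε = 0` the weight is `ψ`, whose integral is `χ(0) = 1`.
  have hlim : ∫ z, ψ z • w = w := by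
    rw [integral_smul_const, h.integral_eq, one_smul]
  have hcont : ∀ z : V m × V m, Continuous fun ε : ℝ =>
      regWeight k ψ ε z • phaseOp a (ε • z.1) w := by
    intro z
    have h1 : Continuous fun ε : ℝ => phaseOp a (ε • z.1) w :=
      (continuous_phaseOp a w).comp (by fun_prop)
    have h2 : Continuous fun ε : ℝ => regWeight k ψ ε z := by
      unfold regWeight
      fun_prop
    exact h2.smul h1
  have main := tendsto_integral_filter_of_dominated_convergence (l := 𝓝[>] (0 : ℝ))
    (μ := (volume : Measure (V m × V m)))
    (F := fun ε z => regWeight k ψ ε z • phaseOp a (ε • z.1) w) (f := fun z => ψ z • w)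
    (fun z => Real.exp ((2 * Real.pi * ‖k‖) * ‖z‖) * ‖ψ z‖ * ‖w‖) ?_ ?_ ?_ ?_
  · rwa [hlim] at main
  · refine Filter.Eventually.of_forall fun ε => Continuous.aestronglyMeasurable ?_
    exact (continuous_regWeight k hψ ε).smul ((continuous_phaseOp a w).comp (by fun_prop))
  · filter_upwards [eventually_le_one] with ε hε
    refine Filter.Eventually.of_forall fun z => ?_
    rw [norm_smul, LinearIsometry.norm_map]
    gcongr
    exact norm_regWeight_le k ψ hε.1.le hε.2 z
  · refine Integrable.mul_const ?_ _
    refine h.decay_right.integrable_of_le (2 * Real.pi * ‖k‖)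
      (Continuous.aestronglyMeasurable (by fun_prop)) fun z => ?_
    rw [Real.norm_of_nonneg (by positivity)]
  · refine Filter.Eventually.of_forall fun z => ?_
    have h0 := ((hcont z).tendsto 0).mono_left (nhdsWithin_le_nhds (s := Set.Ioi 0))
    simpa [regWeight, phaseOp_zero] using h0

/-! ### Approximation of the identity by functions of `X` -/

/-- The Fourier representation of `g(t X)`. -/
theorem schwartzFunction_comp_smul (a : Fin m → ℝ) (g gt : 𝓢(V m, ℂ)) {t : ℝ} (ht : 0 < t)
    (hg : ∀ x, gt x = g (t • x)) (w : Hilb m) :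
    schwartzFunction a gt w = ∫ p, (𝓕 g : 𝓢(V m, ℂ)) p • phaseOp a (t • p) w := by
  have hF : ∀ p, (𝓕 gt : 𝓢(V m, ℂ)) p = ((t ^ m)⁻¹ : ℝ) * (𝓕 g : 𝓢(V m, ℂ)) (t⁻¹ • p) := by
    intro p
    have h1 := Measure.integral_comp_smul (volume : Measure (V m))
      (fun x => Complex.exp (((-2 * Real.pi * inner ℝ x (t⁻¹ • p) : ℝ) : ℂ) * Complex.I) • g x) t
    rw [finrank_euclideanSpace_fin, abs_of_pos (by positivity), Complex.real_smul] at h1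
    rw [SchwartzMap.fourier_coe, SchwartzMap.fourier_coe, Real.fourier_eq', Real.fourier_eq', ← h1]
    refine integral_congr_ae (Filter.Eventually.of_forall fun x => ?_)
    simp only [hg, inner_smul_left, inner_smul_right]
    congr 4
    simp
    field_simp
  rw [schwartzFunction_eq]
  have h2 := Measure.integral_comp_smul (volume : Measure (V m))
    (fun p => ((t ^ m)⁻¹ : ℝ) • (𝓕 g : 𝓢(V m, ℂ)) p • phaseOp a (t • p) w) t⁻¹
  rw [integral_smul (((t ^ m)⁻¹ : ℝ)) fun p => (𝓕 g : 𝓢(V m, ℂ)) p • phaseOp a (t • p) w,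
    finrank_euclideanSpace_fin, abs_of_pos (by positivity), smul_smul,
    inv_pow, inv_inv, mul_inv_cancel₀ (by positivity), one_smul] at h2
  rw [← h2]
  refine integral_congr_ae (Filter.Eventually.of_forall fun p => ?_)
  simp only [hF]
  rw [smul_inv_smul₀ ht.ne', mul_smul, Complex.coe_smul]
  rfl

theorem integral_fourier_eq (g : 𝓢(V m, ℂ)) : ∫ p, (𝓕 g : 𝓢(V m, ℂ)) p = g 0 := by
  have h1 : (𝓕⁻ (𝓕 g) : 𝓢(V m, ℂ)) 0 = g 0 := by rw [FourierTransform.fourierInv_fourier_eq]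
  rw [← h1, SchwartzMap.fourierInv_coe, Real.fourierInv_eq']
  simp

/-- Strong continuity and dominated convergence apply to `g(tX) w = ∫ ĝ(p) U(2πtp) w dp`, and `∫ ĝ =
g(0)`. -/
theorem tendsto_schwartzFunction (a : Fin m → ℝ) (g : 𝓢(V m, ℂ)) (gt : ℝ → 𝓢(V m, ℂ))
    (hg : ∀ t, 0 < t → ∀ x, gt t x = g (t • x)) (w : Hilb m) :
    Filter.Tendsto (fun t => schwartzFunction a (gt t) w) (𝓝[>] 0) (𝓝 (g 0 • w)) := by
  have hlim : ∫ p, (𝓕 g : 𝓢(V m, ℂ)) p • w = g 0 • w := by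
    rw [integral_smul_const, integral_fourier_eq]
  have hcont := (𝓕 g : 𝓢(V m, ℂ)).continuous
  have main := tendsto_integral_filter_of_dominated_convergence (l := 𝓝[>] (0 : ℝ))
    (μ := (volume : Measure (V m)))
    (F := fun t p => (𝓕 g : 𝓢(V m, ℂ)) p • phaseOp a (t • p) w)
    (f := fun p => (𝓕 g : 𝓢(V m, ℂ)) p • w)
    (fun p => ‖(𝓕 g : 𝓢(V m, ℂ)) p‖ * ‖w‖) ?_ ?_ ?_ ?_
  · rw [hlim] at main
    refine main.congr' ?_
    filter_upwards [self_mem_nhdsWithin] with t ht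
    exact (schwartzFunction_comp_smul a g (gt t) ht (hg t ht) w).symm
  · refine Filter.Eventually.of_forall fun t => Continuous.aestronglyMeasurable ?_
    exact hcont.smul ((continuous_phaseOp a w).comp (by fun_prop))
  · refine Filter.Eventually.of_forall fun t => Filter.Eventually.of_forall fun p => ?_
    rw [norm_smul, LinearIsometry.norm_map]
  · exact (𝓕 g : 𝓢(V m, ℂ)).integrable.norm.mul_const _
  · refine Filter.Eventually.of_forall fun p => ?_
    have h1 : Continuous fun t : ℝ => phaseOp a (t • p) w :=
      (continuous_phaseOp a w).comp (by fun_prop)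
    have hc : Continuous fun t : ℝ => (𝓕 g : 𝓢(V m, ℂ)) p • phaseOp a (t • p) w :=
      h1.const_smul ((𝓕 g : 𝓢(V m, ℂ)) p)
    have h0 := (hc.tendsto 0).mono_left (nhdsWithin_le_nhds (s := Set.Ioi 0))
    simpa [phaseOp_zero] using h0

/-- The operators `g(X)`, with `g` and `e^k g` Schwartz functions, separate the vectors. -/
theorem eq_of_schwartzFunction_eq (a : Fin m → ℝ) (k : V m) {v w : Hilb m}
    (h : ∀ g l : 𝓢(V m, ℂ), (∀ x, l x = Real.exp (inner ℝ k x) * g x) →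
      schwartzFunction a g v = schwartzFunction a g w) : v = w := by
  have hg : ∀ t : ℝ, 0 < t → ∃ gt : 𝓢(V m, ℂ), (∀ x, gt x = gaussS one_pos 0 (t • x)) ∧
      schwartzFunction a gt v = schwartzFunction a gt w := by
    intro t ht
    have ht2 : 0 < t ^ 2 := by positivity
    -- The test functions are `e^{-t²|x|²}`: multiplied by `e^{k·x}` they stay Gaussian, and they
    -- tend to `1` as `t → 0`.
    refine ⟨gaussS ht2 0, fun x => ?_, h _ (gaussS ht2 (linForm fun j => k j)) fun x => ?_⟩
    · rw [gaussS_apply, gaussS_apply, gaussFun, gaussFun, norm_smul, mul_pow]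
      simp
    · rw [gaussS_apply, gaussS_apply, gaussFun, gaussFun, linForm_apply, Complex.ofReal_exp,
        ← Complex.exp_add, PiLp.inner_apply]
      congr 1
      simp [mul_comm, add_comm]
  choose! gt hgt using hg
  have h1 := tendsto_schwartzFunction a (gaussS one_pos 0) gt (fun t ht => (hgt t ht).1) v
  have h2 := tendsto_schwartzFunction a (gaussS one_pos 0) gt (fun t ht => (hgt t ht).1) w
  have h3 := tendsto_nhds_unique (h1.congr' (by
    filter_upwards [self_mem_nhdsWithin] with t ht using (hgt t ht).2)) h2
  simpa [gaussS_apply, gaussFun] using h3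

/-- The regularized warped convolutions with symbol `e^{k·x}` converge exactly on the domain of
`e^{k·X}`, with limit `e^{k·X}`. -/
theorem tendsto_warp_iff (a : Fin m → ℝ) (k : V m) (v w : Hilb m) :
    (∀ χ : 𝓢(WithLp 2 (V m × V m), ℂ), IsCutoff χ →
      Filter.Tendsto (fun ε => ∫ z, warpWeight k (fun z => χ (WithLp.toLp 2 z)) ε z •
        phaseOp a ((2 * Real.pi)⁻¹ • z.2) v) (𝓝[>] 0) (𝓝 w))
      ↔ HasFunctionValue a (fun x => Real.exp (inner ℝ k x)) v w := by
  constructor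
  · intro hw g l hl
    -- One cut-off suffices here, but one must exist, or the hypothesis would be vacuous.
    obtain ⟨χ, hχ⟩ := exists_isCutoff (m := m)
    have hp := hχ.cutoffPair
    have h1 := ((schwartzFunctionCLM a g).continuous.tendsto w).comp (hw χ hχ)
    have h2 := ((schwartzFunctionCLM a l).continuous.tendsto v).comp (tendsto_reg hp a k v)
    refine tendsto_nhds_unique h2 (h1.congr' ?_)
    filter_upwards [eventually_le_one] with ε hε
    exact schwartzFunction_warp hp a k hε.1 hε.2 g l hl v
  · intro hw χ hχ
    have hp := hχ.cutoffPair
    refine (tendsto_reg hp a k w).congr' ?_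
    filter_upwards [eventually_le_one] with ε hε
    -- The two regularized vectors agree exactly for each `ε ≤ 1`, not only in the limit.
    refine eq_of_schwartzFunction_eq a k fun g l hl => ?_
    have hi := integrable_regWeight k hp.continuous_right hp.decay_right hε.1.le hε.2
    rw [schwartzFunction_warp hp a k hε.1 hε.2 g l hl v,
      schwartzFunction_integral_comm a hi (τ := fun z : V m × V m => ε • z.1) (by fun_prop),
      schwartzFunction_integral_comm a hi (τ := fun z : V m × V m => ε • z.1) (by fun_prop),
      hw g l hl]

/-! ### Superpositions of the unitaries on Schwartz functions -/

theorem fderiv_single (φ : 𝓢(V m, ℂ)) (x : V m) (j : Fin m) :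
    fderiv ℝ φ x (EuclideanSpace.single j 1) = Complex.I * momOp j φ x := by
  rw [momOp_apply, ← mul_assoc, mul_neg, Complex.I_mul_I, neg_neg, one_mul]

theorem inner_ofSchwartz (φ ψ : 𝓢(V m, ℂ)) :
    inner ℂ (ofSchwartz φ) (ofSchwartz ψ) = ∫ x, inner ℂ (φ x) (ψ x) :=
  SchwartzMap.inner_toL2_toL2_eq φ ψ _

/-- Derivatives are multiplied by positive numbers under the action of the unitary group. -/
theorem momOp_unitaryS (a : Fin m → ℝ) (p : V m) (j : Fin m) (φ : 𝓢(V m, ℂ)) :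
    momOp j (unitaryS a p φ) = (Real.exp (a j * p j) : ℂ) • unitaryS a p (momOp j φ) := by
  ext x
  have h1 : (unitaryS a p φ : V m → ℂ) = fun y => dilationFactor a p * φ (dilation a p y) :=
    funext (unitaryS_apply a p φ)
  have h2 : HasFDerivAt (fun y => (dilationFactor a p : ℂ) * φ (dilation a p y))
      ((dilationFactor a p : ℂ) • (fderiv ℝ φ (dilation a p x)).comp
        (dilation a p : V m →L[ℝ] V m)) x :=
    ((φ.differentiableAt.hasFDerivAt).comp x (dilation a p).hasFDerivAt).const_mul _
  have h3 : dilation a p (EuclideanSpace.single j 1)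
      = Real.exp (a j * p j) • (EuclideanSpace.single j 1 : V m) := by
    ext ν
    by_cases h : ν = j
    · subst h; simp
    · simp [h]
  change momOp j (unitaryS a p φ) x = (Real.exp (a j * p j) : ℂ) * unitaryS a p (momOp j φ) x
  rw [momOp_apply, h1, h2.fderiv, unitaryS_apply, momOp_apply]
  change -Complex.I * ((dilationFactor a p : ℂ) *
    fderiv ℝ φ (dilation a p x) (dilation a p (EuclideanSpace.single j 1))) = _
  rw [h3, map_smul, Complex.real_smul]
  ring

/-- An exponential rate that bounds the dilations by `2πp`. -/
def growthRate (a : Fin m → ℝ) : ℝ := 2 * Real.pi * ∑ j, |a j|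

theorem growthRate_nonneg (a : Fin m → ℝ) : 0 ≤ growthRate a := by
  have := Real.pi_pos
  unfold growthRate
  positivity

theorem abs_mul_le_growthRate (a : Fin m → ℝ) (p : V m) (j : Fin m) :
    |a j * ((2 * Real.pi) • p) j| ≤ growthRate a * ‖p‖ := by
  have hπ := Real.pi_pos
  have h1 : |p j| ≤ ‖p‖ := PiLp.norm_apply_le p j
  have h2 : |a j| ≤ ∑ j, |a j| :=
    Finset.single_le_sum (f := fun j => |a j|) (fun _ _ => abs_nonneg _) (Finset.mem_univ j)
  rw [PiLp.smul_apply, smul_eq_mul, abs_mul, abs_mul, abs_of_pos (by positivity : 0 < 2 * Real.pi),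
    growthRate]
  calc |a j| * (2 * Real.pi * |p j|) ≤ (∑ j, |a j|) * (2 * Real.pi * ‖p‖) := by gcongr
    _ = _ := by ring

theorem dilationFactor_le (a : Fin m → ℝ) (p : V m) :
    dilationFactor a ((2 * Real.pi) • p) ≤ Real.exp (growthRate a * ‖p‖) := by
  have hπ := Real.pi_pos
  refine Real.exp_le_exp.2 ?_
  have h1 : ∑ j, a j * ((2 * Real.pi) • p) j ≤ growthRate a * ‖p‖ := by
    rw [growthRate, Finset.mul_sum, Finset.sum_mul]
    refine Finset.sum_le_sum fun j _ => ?_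
    have h1 : |p j| ≤ ‖p‖ := PiLp.norm_apply_le p j
    rw [PiLp.smul_apply, smul_eq_mul]
    calc a j * (2 * Real.pi * p j) ≤ |a j * (2 * Real.pi * p j)| := le_abs_self _
      _ = 2 * Real.pi * |a j| * |p j| := by
        rw [abs_mul, abs_mul, abs_of_pos (by positivity : 0 < 2 * Real.pi)]; ring
      _ ≤ 2 * Real.pi * |a j| * ‖p‖ := by gcongr
  have h2 : 0 ≤ growthRate a * ‖p‖ := mul_nonneg (growthRate_nonneg a) (norm_nonneg p)
  linarith

/-- The inverse dilation stretches each coordinate by at most `e^{growthRate a * ‖p‖}`. -/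
theorem norm_le_dilation (a : Fin m → ℝ) (p x : V m) :
    ‖x‖ ≤ Real.exp (growthRate a * ‖p‖) * ‖dilation a ((2 * Real.pi) • p) x‖ := by
  rw [← Real.norm_of_nonneg (Real.exp_pos (growthRate a * ‖p‖)).le, ← norm_smul,
    EuclideanSpace.norm_eq, EuclideanSpace.norm_eq]
  refine Real.sqrt_le_sqrt (Finset.sum_le_sum fun j _ => ?_)
  gcongr
  rw [PiLp.smul_apply, dilation_apply, smul_eq_mul, ← mul_assoc, ← Real.exp_add, norm_mul,
    Real.norm_of_nonneg (Real.exp_pos _).le]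
  refine le_mul_of_one_le_left (norm_nonneg _) (Real.one_le_exp ?_)
  have := (abs_le.1 (abs_mul_le_growthRate a p j)).1
  linarith

/-- Schwartz seminorms grow only exponentially in `p`. Of the `k + 1` factors, `k` come from `‖x‖^k`
and one from `dilationFactor`. -/
theorem pow_mul_unitaryS_le (a : Fin m → ℝ) (p x : V m) (φ : 𝓢(V m, ℂ)) (k : ℕ) :
    ‖x‖ ^ k * ‖unitaryS a ((2 * Real.pi) • p) φ x‖
      ≤ Real.exp ((k + 1) * growthRate a * ‖p‖) * SchwartzMap.seminorm ℝ k 0 φ := by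
  set y := dilation a ((2 * Real.pi) • p) x with hy
  set R := Real.exp (growthRate a * ‖p‖) with hR
  have hR0 : 0 < R := Real.exp_pos _
  have h1 : ‖unitaryS a ((2 * Real.pi) • p) φ x‖ ≤ R * ‖φ y‖ := by
    rw [unitaryS_apply, norm_mul, Complex.norm_real,
      Real.norm_of_nonneg (dilationFactor_pos a _).le]
    gcongr
    exact dilationFactor_le a p
  calc ‖x‖ ^ k * ‖unitaryS a ((2 * Real.pi) • p) φ x‖
      ≤ (R * ‖y‖) ^ k * (R * ‖φ y‖) := by
        gcongr
        exact norm_le_dilation a p x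
    _ = R ^ (k + 1) * (‖y‖ ^ k * ‖φ y‖) := by ring
    _ ≤ R ^ (k + 1) * SchwartzMap.seminorm ℝ k 0 φ := by
        gcongr
        exact SchwartzMap.norm_pow_mul_le_seminorm ℝ φ k y
    _ = _ := by
        rw [hR, ← Real.exp_nat_mul]
        push_cast
        ring_nf

theorem continuous_unitaryS (a : Fin m → ℝ) (φ : 𝓢(V m, ℂ)) :
    Continuous fun z : V m × V m => unitaryS a ((2 * Real.pi) • z.1) φ z.2 := by
  simp only [unitaryS_apply]
  refine (Complex.continuous_ofReal.comp ((continuous_dilationFactor a).comp (by fun_prop))).mul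
    (φ.continuous.comp ((PiLp.continuous_toLp 2 _).comp (continuous_pi fun μ => ?_)))
  simp only [PiLp.smul_apply]
  fun_prop

theorem continuous_unitaryS_left (a : Fin m → ℝ) (φ : 𝓢(V m, ℂ)) (x : V m) :
    Continuous fun p : V m => unitaryS a ((2 * Real.pi) • p) φ x :=
  (continuous_unitaryS a φ).comp (f := fun p : V m => (p, x)) (by fun_prop)

/-- The superposition `∫ h(p) U(2πp) φ dp`, pointwise. -/
def smear (a : Fin m → ℝ) (h : V m → ℂ) (φ : 𝓢(V m, ℂ)) (x : V m) : ℂ :=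
  ∫ p, h p * unitaryS a ((2 * Real.pi) • p) φ x

theorem SuperexpDecay.mul_exp_bound {h h' : V m → ℂ} (hd : SuperexpDecay h) (K : ℝ)
    (hb : ∀ p, ‖h' p‖ ≤ Real.exp (K * ‖p‖) * ‖h p‖) : SuperexpDecay h' := by
  intro c
  obtain ⟨C, hC⟩ := hd (c + K)
  refine ⟨C, fun p => (hb p).trans ?_⟩
  calc Real.exp (K * ‖p‖) * ‖h p‖
      ≤ Real.exp (K * ‖p‖) * (C * Real.exp (-((c + K) * ‖p‖))) := by gcongr; exact hC p
    _ = C * (Real.exp (K * ‖p‖) * Real.exp (-((c + K) * ‖p‖))) := by ring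
    _ = C * Real.exp (-(c * ‖p‖)) := by rw [← Real.exp_add]; congr 2; ring

/-- The weight `h` multiplied by the dilation factor of the `j`-th derivative. -/
def derivWeight (a : Fin m → ℝ) (j : Fin m) (h : V m → ℂ) (p : V m) : ℂ :=
  Real.exp (a j * ((2 * Real.pi) • p) j) * h p

theorem continuous_derivWeight (a : Fin m → ℝ) (j : Fin m) {h : V m → ℂ} (hc : Continuous h) :
    Continuous (derivWeight a j h) := by
  unfold derivWeight
  simp only [PiLp.smul_apply]
  fun_prop

theorem SuperexpDecay.derivWeight {h : V m → ℂ} (hd : SuperexpDecay h) (a : Fin m → ℝ)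
    (j : Fin m) : SuperexpDecay (derivWeight a j h) := by
  refine hd.mul_exp_bound (growthRate a) fun p => ?_
  rw [WarpedLineElement.derivWeight, norm_mul, norm_real_exp]
  exact mul_le_mul_of_nonneg_right (Real.exp_le_exp.2
    ((le_abs_self _).trans (abs_mul_le_growthRate a p j))) (norm_nonneg _)

theorem integrable_smear_integrand (a : Fin m → ℝ) {h : V m → ℂ} (hc : Continuous h)
    (hd : SuperexpDecay h) (φ : 𝓢(V m, ℂ)) (x : V m) :
    Integrable fun p => h p * unitaryS a ((2 * Real.pi) • p) φ x := by
  have h1 := hd.integrable_of_le (μ := volume) (growthRate a)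
    (g := fun p => Real.exp (growthRate a * ‖p‖) * ‖h p‖)
    (Continuous.aestronglyMeasurable (by fun_prop)) fun p => by
      rw [Real.norm_of_nonneg (by positivity)]
  refine (h1.mul_const (SchwartzMap.seminorm ℝ 0 0 φ)).mono'
    ((hc.mul (continuous_unitaryS_left a φ x)).aestronglyMeasurable)
    (Filter.Eventually.of_forall fun p => ?_)
  have h2 := pow_mul_unitaryS_le a p x φ 0
  rw [pow_zero, one_mul, Nat.cast_zero, zero_add, one_mul] at h2
  rw [norm_mul]
  calc ‖h p‖ * ‖unitaryS a ((2 * Real.pi) • p) φ x‖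
      ≤ ‖h p‖ * (Real.exp (growthRate a * ‖p‖) * SchwartzMap.seminorm ℝ 0 0 φ) := by gcongr
    _ = _ := by ring

/-- The `j`-th summand of the derivative of the integrand of a superposition. -/
def smearDerivTerm (a : Fin m → ℝ) (h : V m → ℂ) (φ : 𝓢(V m, ℂ)) (j : Fin m) (x p : V m) :
    V m →L[ℝ] ℂ :=
  ContinuousLinearMap.smulRightL ℝ (V m) ℂ (EuclideanSpace.proj j)
    (Complex.I * (derivWeight a j h p * unitaryS a ((2 * Real.pi) • p) (momOp j φ) x))

theorem smearDerivTerm_apply (a : Fin m → ℝ) (h : V m → ℂ) (φ : 𝓢(V m, ℂ)) (j : Fin m)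
    (x p v : V m) : smearDerivTerm a h φ j x p v = (v j : ℂ) * (Complex.I *
      (derivWeight a j h p * unitaryS a ((2 * Real.pi) • p) (momOp j φ) x)) :=
  Complex.real_smul

theorem integrable_smearDerivTerm (a : Fin m → ℝ) {h : V m → ℂ} (hc : Continuous h)
    (hd : SuperexpDecay h) (φ : 𝓢(V m, ℂ)) (j : Fin m) (x : V m) :
    Integrable (smearDerivTerm a h φ j x) :=
  (ContinuousLinearMap.smulRightL ℝ (V m) ℂ (EuclideanSpace.proj j)).integrable_comp
    ((integrable_smear_integrand a (continuous_derivWeight a j hc) (hd.derivWeight a j)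
      (momOp j φ) x).const_mul Complex.I)

theorem integral_smearDerivTerm (a : Fin m → ℝ) {h : V m → ℂ} (hc : Continuous h)
    (hd : SuperexpDecay h) (φ : 𝓢(V m, ℂ)) (j : Fin m) (x v : V m) :
    (∫ p, smearDerivTerm a h φ j x p) v
      = (v j : ℂ) * (Complex.I * smear a (derivWeight a j h) (momOp j φ) x) := by
  rw [ContinuousLinearMap.integral_apply (integrable_smearDerivTerm a hc hd φ j x)]
  simp only [smearDerivTerm_apply, smear, integral_const_mul]

theorem norm_smearDerivTerm_le (a : Fin m → ℝ) (h : V m → ℂ) (φ : 𝓢(V m, ℂ)) (j : Fin m)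
    (x p : V m) : ‖smearDerivTerm a h φ j x p‖ ≤
      (Real.exp (growthRate a * ‖p‖) * ‖derivWeight a j h p‖) *
        SchwartzMap.seminorm ℝ 0 0 (momOp j φ) := by
  have h2 := pow_mul_unitaryS_le a p x (momOp j φ) 0
  rw [pow_zero, one_mul, Nat.cast_zero, zero_add, one_mul] at h2
  refine ContinuousLinearMap.opNorm_le_bound _ (by positivity) fun v => ?_
  rw [smearDerivTerm_apply, norm_mul, norm_mul, norm_mul, Complex.norm_I, one_mul,
    Complex.norm_real]
  have h3 : ‖v j‖ ≤ ‖v‖ := PiLp.norm_apply_le v j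
  calc ‖v j‖ * (‖derivWeight a j h p‖ * ‖unitaryS a ((2 * Real.pi) • p) (momOp j φ) x‖)
      ≤ ‖v‖ * (‖derivWeight a j h p‖ * (Real.exp (growthRate a * ‖p‖) *
          SchwartzMap.seminorm ℝ 0 0 (momOp j φ))) := by gcongr
    _ = _ := by ring

theorem integrable_exp_mul_norm {h : V m → ℂ} (hc : Continuous h) (hd : SuperexpDecay h) (K : ℝ) :
    Integrable fun p => Real.exp (K * ‖p‖) * ‖h p‖ :=
  hd.integrable_of_le K (Continuous.aestronglyMeasurable (by fun_prop)) fun p => by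
    rw [Real.norm_of_nonneg (by positivity)]

theorem hasFDerivAt_unitaryS (a : Fin m → ℝ) (h : V m → ℂ) (φ : 𝓢(V m, ℂ)) (p x : V m) :
    HasFDerivAt (fun x => h p * unitaryS a ((2 * Real.pi) • p) φ x)
      (∑ j, smearDerivTerm a h φ j x p) x := by
  refine (((unitaryS a ((2 * Real.pi) • p) φ).differentiableAt (x := x)).hasFDerivAt.const_mul
    (h p)).congr_fderiv ?_
  rw [fderiv_eq_sum_basis (EuclideanSpace.basisFun (Fin m) ℝ).toBasis]
  simp only [Finset.smul_sum]
  refine Finset.sum_congr rfl fun j _ => ?_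
  ext v
  rw [smearDerivTerm_apply]
  simp only [OrthonormalBasis.coe_toBasis, EuclideanSpace.basisFun_apply, Function.comp_apply,
    fderiv_single, momOp_unitaryS, derivWeight]
  change h p * ((v j : ℝ) • (Complex.I * (((Real.exp _ : ℝ) : ℂ) * _))) = _
  simp only [Complex.real_smul]
  ring

theorem integrable_finsetSum_of_normed {ι Z F : Type*} [MeasurableSpace Z] {ν : Measure Z}
    [NormedAddCommGroup F] (s : Finset ι) {f : ι → Z → F} (hf : ∀ i ∈ s, Integrable (f i) ν) :
    Integrable (fun z => ∑ i ∈ s, f i z) ν :=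
  integrable_finsetSum s hf

/-- Differentiation under the integral; the dominating function is uniform in `x`, so no
neighbourhood has to be chosen. -/
theorem hasFDerivAt_smear (a : Fin m → ℝ) {h : V m → ℂ} (hc : Continuous h)
    (hd : SuperexpDecay h) (φ : 𝓢(V m, ℂ)) (x : V m) :
    HasFDerivAt (smear a h φ) (∑ j, ∫ p, smearDerivTerm a h φ j x p) x := by
  have hterm : ∀ j ∈ Finset.univ, Integrable (smearDerivTerm a h φ j x) := fun j _ =>
    integrable_smearDerivTerm a hc hd φ j x
  have hFi : Integrable (fun p => ∑ j, smearDerivTerm a h φ j x p) :=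
    integrable_finsetSum_of_normed _ hterm
  have h1 : ∀ᶠ y in 𝓝 x, AEStronglyMeasurable
      (fun p => h p * unitaryS a ((2 * Real.pi) • p) φ y) volume :=
    Filter.Eventually.of_forall fun y =>
      (hc.mul (continuous_unitaryS_left a φ y)).aestronglyMeasurable
  have h2 : ∀ᵐ p, ∀ y ∈ Set.univ, ‖∑ j, smearDerivTerm a h φ j y p‖ ≤
      ∑ j, (Real.exp (growthRate a * ‖p‖) * ‖derivWeight a j h p‖) *
        SchwartzMap.seminorm ℝ 0 0 (momOp j φ) :=
    Filter.Eventually.of_forall fun p y _ =>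
      (norm_sum_le _ _).trans (Finset.sum_le_sum fun j _ => norm_smearDerivTerm_le a h φ j y p)
  have h3 : Integrable fun p => ∑ j, (Real.exp (growthRate a * ‖p‖) * ‖derivWeight a j h p‖) *
        SchwartzMap.seminorm ℝ 0 0 (momOp j φ) :=
    integrable_finsetSum _ fun j _ => (integrable_exp_mul_norm
      (continuous_derivWeight a j hc) (hd.derivWeight a j) _).mul_const _
  have h4 : ∀ᵐ p, ∀ y ∈ Set.univ, HasFDerivAt
      (fun y => h p * unitaryS a ((2 * Real.pi) • p) φ y) (∑ j, smearDerivTerm a h φ j y p) y :=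
    Filter.Eventually.of_forall fun p y _ => hasFDerivAt_unitaryS a h φ p y
  rw [← integral_finsetSum _ hterm]
  exact hasFDerivAt_integral_of_dominated_of_fderiv_le (𝕜 := ℝ) (E := ℂ) (H := V m)
    (F := fun y p => h p * unitaryS a ((2 * Real.pi) • p) φ y)
    (F' := fun y p => ∑ j, smearDerivTerm a h φ j y p)
    Filter.univ_mem h1 (integrable_smear_integrand a hc hd φ x) hFi.aestronglyMeasurable h2 h3 h4

theorem fderiv_smear_single (a : Fin m → ℝ) {h : V m → ℂ} (hc : Continuous h)
    (hd : SuperexpDecay h) (φ : 𝓢(V m, ℂ)) (x : V m) (j : Fin m) :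
    fderiv ℝ (smear a h φ) x (EuclideanSpace.single j 1)
      = Complex.I * smear a (derivWeight a j h) (momOp j φ) x := by
  rw [(hasFDerivAt_smear a hc hd φ x).fderiv, sum_apply]
  simp only [integral_smearDerivTerm a hc hd]
  rw [Finset.sum_eq_single j (fun i _ hi => by simp [hi]) (by simp)]
  simp

theorem exists_schwartzMap_smear (a : Fin m → ℝ) {h : V m → ℂ} (hc : Continuous h)
    (hd : SuperexpDecay h) (φ : 𝓢(V m, ℂ)) : ∃ Φ : 𝓢(V m, ℂ), ∀ x, Φ x = smear a h φ x := by
  -- The class contains the superpositions for all weights and all Schwartz functions, since a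
  -- derivative changes both: `h` becomes a multiple of `derivWeight a j h`, and `φ` becomes `momOp
  -- j φ`.
  refine exists_schwartzMap_of_closed (EuclideanSpace.basisFun (Fin m) ℝ).toBasis
    (S := fun f => ∃ (h : V m → ℂ) (φ : 𝓢(V m, ℂ)), Continuous h ∧ SuperexpDecay h ∧
      f = smear a h φ) ?_ ?_ ?_ _ ⟨h, φ, hc, hd, rfl⟩
  · rintro f ⟨h, φ, hc, hd, rfl⟩ k
    refine ⟨∫ p, Real.exp ((k + 1) * growthRate a * ‖p‖) * ‖h p‖ * SchwartzMap.seminorm ℝ k 0 φ,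
      fun x => ?_⟩
    rw [← Real.norm_of_nonneg (show 0 ≤ ‖x‖ ^ k by positivity), ← Complex.norm_real, ← norm_mul,
      smear, ← integral_const_mul]
    refine norm_integral_le_of_norm_le (Integrable.mul_const ?_ _)
      (Filter.Eventually.of_forall fun p => ?_)
    · exact hd.integrable_of_le ((k + 1) * growthRate a)
        (Continuous.aestronglyMeasurable (by fun_prop)) fun p => by
          rw [Real.norm_of_nonneg (by positivity)]
    · rw [norm_mul, norm_mul, Complex.norm_real, Real.norm_of_nonneg (by positivity)]
      calc ‖x‖ ^ k * (‖h p‖ * ‖unitaryS a ((2 * Real.pi) • p) φ x‖)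
          = ‖h p‖ * (‖x‖ ^ k * ‖unitaryS a ((2 * Real.pi) • p) φ x‖) := by ring
        _ ≤ ‖h p‖ * (Real.exp ((k + 1) * growthRate a * ‖p‖) *
              SchwartzMap.seminorm ℝ k 0 φ) := by
            exact mul_le_mul_of_nonneg_left (pow_mul_unitaryS_le a p x φ k) (norm_nonneg _)
        _ = _ := by ring
  · rintro f ⟨h, φ, hc, hd, rfl⟩ x
    exact (hasFDerivAt_smear a hc hd φ x).differentiableAt
  · rintro f ⟨h, φ, hc, hd, rfl⟩ j
    refine ⟨fun p => Complex.I * derivWeight a j h p, momOp j φ,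
      continuous_const.mul (continuous_derivWeight a j hc),
      (hd.derivWeight a j).mul_exp_bound 0 fun p => by simp, ?_⟩
    funext x
    rw [OrthonormalBasis.coe_toBasis, EuclideanSpace.basisFun_apply,
      fderiv_smear_single a hc hd φ x j]
    simp only [smear, mul_assoc, integral_const_mul]

/-- The superposition `∫ h(p) U(2πp) φ dp` as a Schwartz function. -/
def smearS (a : Fin m → ℝ) {h : V m → ℂ} (hc : Continuous h) (hd : SuperexpDecay h)
    (φ : 𝓢(V m, ℂ)) : 𝓢(V m, ℂ) := (exists_schwartzMap_smear a hc hd φ).choose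

theorem smearS_apply (a : Fin m → ℝ) {h : V m → ℂ} (hc : Continuous h) (hd : SuperexpDecay h)
    (φ : 𝓢(V m, ℂ)) (x : V m) : smearS a hc hd φ x = smear a h φ x :=
  (exists_schwartzMap_smear a hc hd φ).choose_spec x

theorem momOp_smearS (a : Fin m → ℝ) {h : V m → ℂ} (hc : Continuous h) (hd : SuperexpDecay h)
    (φ : 𝓢(V m, ℂ)) (j : Fin m) :
    momOp j (smearS a hc hd φ)
      = smearS a (continuous_derivWeight a j hc) (hd.derivWeight a j) (momOp j φ) := by
  ext x
  have h1 : (smearS a hc hd φ : V m → ℂ) = smear a h φ := funext (smearS_apply a hc hd φ)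
  rw [momOp_apply, smearS_apply, h1, fderiv_smear_single a hc hd φ x j, ← mul_assoc]
  simp

/-- The left side is an integral at each point, the right side a Bochner integral in `L²`. Fubini
identifies their pairings with Schwartz functions, which are dense. -/
theorem ofSchwartz_smearS (a : Fin m → ℝ) {h : V m → ℂ} (hc : Continuous h)
    (hd : SuperexpDecay h) (φ : 𝓢(V m, ℂ)) :
    ofSchwartz (smearS a hc hd φ) = ∫ p, h p • phaseOp a p (ofSchwartz φ) := by
  have hi := integrable_smul_phaseOp a (hd.integrable (μ := volume) hc) measurable_id (ofSchwartz φ)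
  have key : ∀ ψ : 𝓢(V m, ℂ), inner ℂ (ofSchwartz ψ) (ofSchwartz (smearS a hc hd φ))
      = inner ℂ (ofSchwartz ψ) (∫ p, h p • phaseOp a p (ofSchwartz φ)) := by
    intro ψ
    refine Eq.trans ?_ (integral_inner hi (ofSchwartz ψ))
    have hU : ∀ p, inner ℂ (ofSchwartz ψ) (h p • phaseOp a (id p) (ofSchwartz φ))
        = ∫ x, inner ℂ (ψ x) (h p * unitaryS a ((2 * Real.pi) • p) φ x) := by
      intro p
      rw [id, phaseOp, unitary_ofSchwartz, inner_smul_right, inner_ofSchwartz,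
        ← integral_const_mul]
      refine integral_congr_ae (Filter.Eventually.of_forall fun x => ?_)
      simp only
      rw [← smul_eq_mul (h p) (unitaryS a _ φ x), inner_smul_right]
    simp only [hU]
    rw [integral_integral_swap, inner_ofSchwartz]
    · refine integral_congr_ae (Filter.Eventually.of_forall fun x => ?_)
      simp only
      rw [smearS_apply, smear, integral_inner (integrable_smear_integrand a hc hd φ x)]
    · have h1 := hd.integrable_of_le (μ := volume) (growthRate a)
        (g := fun p => Real.exp (growthRate a * ‖p‖) * ‖h p‖)
        (Continuous.aestronglyMeasurable (by fun_prop)) fun p => by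
          rw [Real.norm_of_nonneg (by positivity)]
      have h2 := h1.mul_prod ((ψ.integrable (μ := volume)).norm.mul_const
        (SchwartzMap.seminorm ℝ 0 0 φ))
      refine h2.mono' (Continuous.aestronglyMeasurable ?_) (Filter.Eventually.of_forall fun z => ?_)
      · have := continuous_unitaryS a φ
        have := ψ.continuous
        simp only [Function.uncurry_def]
        fun_prop
      · have h3 := pow_mul_unitaryS_le a z.1 z.2 φ 0
        rw [pow_zero, one_mul, Nat.cast_zero, zero_add, one_mul] at h3
        refine (norm_inner_le_norm _ _).trans ?_
        rw [norm_mul]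
        calc ‖ψ z.2‖ * (‖h z.1‖ * ‖unitaryS a ((2 * Real.pi) • z.1) φ z.2‖)
            ≤ ‖ψ z.2‖ * (‖h z.1‖ * (Real.exp (growthRate a * ‖z.1‖) *
              SchwartzMap.seminorm ℝ 0 0 φ)) := by gcongr
          _ = _ := by ring
  refine ext_inner_left ℂ fun v => ?_
  exact congrFun (denseRange_ofSchwartz.equalizer
    (continuous_id.inner continuous_const) (continuous_id.inner continuous_const)
    (funext key)) v

theorem ofReal_smul_hilb (c : ℝ) (w : Hilb m) : (c : ℂ) • w = c • w := by
  rw [Complex.coe_smul]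
  rfl

/-! ### The differentials -/

theorem momOp_comm (b c : Fin m) : (momOp b * momOp c : Module.End ℂ 𝓢(V m, ℂ))
    = momOp c * momOp b := by
  have key : ∀ (b c : Fin m) (φ : 𝓢(V m, ℂ)) (x : V m), momOp b (momOp c φ) x
      = -(fderiv ℝ (fderiv ℝ φ) x (EuclideanSpace.single b 1) (EuclideanSpace.single c 1)) := by
    intro b c φ x
    have h1 : (momOp c φ : V m → ℂ)
        = fun y => -Complex.I * fderiv ℝ φ y (EuclideanSpace.single c 1) :=
      funext (momOp_apply c φ)
    have h2 : DifferentiableAt ℝ (fderiv ℝ φ) x :=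
      ((φ.smooth 2).fderiv_right (m := 1) (by norm_num)).differentiable (by simp) x
    have h3 : HasFDerivAt (fun y => -Complex.I * fderiv ℝ φ y (EuclideanSpace.single c 1))
        (-Complex.I • (ContinuousLinearMap.apply ℝ ℂ (EuclideanSpace.single c 1 : V m)).comp
          (fderiv ℝ (fderiv ℝ φ) x)) x :=
      (((ContinuousLinearMap.apply ℝ ℂ (EuclideanSpace.single c 1 : V m)).hasFDerivAt).comp x
        h2.hasFDerivAt).const_mul (-Complex.I)
    rw [momOp_apply, h1, h3.fderiv]
    change -Complex.I * (-Complex.I * _) = _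
    rw [← mul_assoc, neg_mul_neg, Complex.I_mul_I, neg_one_mul]
    rfl
  ext φ x
  change momOp b (momOp c φ) x = momOp c (momOp b φ) x
  rw [key, key]
  have hs : IsSymmSndFDerivAt ℝ φ x :=
    ((φ.smooth 2).contDiffAt).isSymmSndFDerivAt (by simp)
  rw [hs.eq]

theorem momOp_mul_posOp (b c : Fin m) : (momOp b * posOp c : Module.End ℂ 𝓢(V m, ℂ))
    = posOp c * momOp b + (if b = c then -Complex.I else 0) • 1 := by
  ext φ x
  change momOp b (posOp c φ) x = posOp c (momOp b φ) x + (if b = c then -Complex.I else 0) * φ x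
  have h1 : (posOp c φ : V m → ℂ) = fun y => ((y c : ℝ) : ℂ) * φ y := funext (posOp_apply c φ)
  have h2 : HasFDerivAt (fun y : V m => ((y c : ℝ) : ℂ))
      (Complex.ofRealCLM.comp (EuclideanSpace.proj c : V m →L[ℝ] ℝ)) x :=
    (Complex.ofRealCLM.comp (EuclideanSpace.proj c : V m →L[ℝ] ℝ)).hasFDerivAt
  have h3 : HasFDerivAt (fun y : V m => ((y c : ℝ) : ℂ) * φ y) _ x :=
    h2.mul (φ.differentiableAt (x := x)).hasFDerivAt
  rw [momOp_apply, h1, h3.fderiv, posOp_apply, momOp_apply]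
  by_cases h : b = c
  · subst h
    simp
    ring
  · simp [h, Ne.symm h]
    ring

/-- `P^b` commutes with `P^μ`, and `[P^b, Q^μ]` is a scalar `c`, so the symmetrized product
contributes `2c P^μ`; the `2` cancels the one in `a^μ / 2`. -/
theorem lie_momOp_coordOp (a : Fin m → ℝ) (b μ : Fin m) :
    (⁅momOp b, coordOp a μ⁆ : Module.End ℂ 𝓢(V m, ℂ))
      = (if b = μ then -Complex.I * a μ else 0) • momOp μ := by
  set c : ℂ := if b = μ then -Complex.I else 0 with hc
  have h1 : (momOp b * posOp μ : Module.End ℂ 𝓢(V m, ℂ)) = posOp μ * momOp b + c • 1 :=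
    momOp_mul_posOp b μ
  have h2 := momOp_comm b μ
  have h3 : (momOp b * (posOp μ * momOp μ + momOp μ * posOp μ) : Module.End ℂ 𝓢(V m, ℂ))
      = (posOp μ * momOp μ + momOp μ * posOp μ) * momOp b + (2 * c) • momOp μ := by
    rw [mul_add, ← mul_assoc, h1, ← mul_assoc, h2, mul_assoc (momOp μ), h1]
    simp only [add_mul, mul_add, mul_assoc, h2, smul_mul_assoc, mul_smul_comm, one_mul, mul_one,
      two_mul, add_smul]
    abel
  rw [Ring.lie_def, coordOp, mul_smul_comm, smul_mul_assoc, h3, smul_add, add_sub_cancel_left,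
    smul_smul]
  congr 1
  rw [hc]
  split_ifs <;> ring

/-- The differentials are multiples of the momentum operators. -/
theorem diffOp_eq (a q : Fin m → ℝ) (μ : Fin m) :
    diffOp a q μ = ((a μ * q μ : ℝ) : ℂ) • momOp μ := by
  rw [diffOp, Finset.sum_eq_single μ]
  · rw [lie_momOp_coordOp, if_pos rfl, smul_smul, smul_smul]
    congr 1
    push_cast
    linear_combination (-(q μ : ℂ) * a μ) * Complex.I_mul_I
  · intro b _ hb
    rw [lie_momOp_coordOp, if_neg hb]
    simp
  · simp

theorem diffOp_diffOp_apply (a q : Fin m → ℝ) (μ : Fin m) (φ : 𝓢(V m, ℂ)) :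
    diffOp a q μ (diffOp a q μ φ)
      = (((a μ * q μ) ^ 2 : ℝ) : ℂ) • momOp μ (momOp μ φ) := by
  rw [diffOp_eq, LinearMap.smul_apply, LinearMap.smul_apply, map_smul, smul_smul]
  congr 1
  push_cast
  ring

/-- The adjoint action rescales the squares of the differentials. -/
theorem adjAction_diffOp (a q : Fin m → ℝ) (p : V m) (μ : Fin m) (φ : 𝓢(V m, ℂ)) :
    adjAction a p (diffOp a q μ * diffOp a q μ) φ
      = ((Real.exp (-2 * a μ * p μ) : ℝ) : ℂ) • diffOp a q μ (diffOp a q μ φ) := by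
  change unitaryS a p (diffOp a q μ (diffOp a q μ (unitaryS a (-p) φ))) = _
  -- Each of the two derivatives picks up `e^{-a_μ p_μ}` on passing `U(-p)`.
  rw [diffOp_diffOp_apply, momOp_unitaryS, map_smul (momOp μ), momOp_unitaryS, diffOp_diffOp_apply]
  simp only [map_smul]
  rw [← unitaryS_add, add_neg_cancel, unitaryS_zero, smul_smul, smul_smul, smul_smul,
    mul_comm (((Real.exp (-2 * a μ * p μ) : ℝ) : ℂ)), mul_assoc]
  congr 2
  rw [← Complex.ofReal_mul, ← Real.exp_add]
  congr 2
  simp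
  ring

/-! ### The domain of a deformed square -/

/-- The linear form `x ↦ -2 a_μ (Θ x)_μ`, as a vector. -/
def warpVector (a : Fin m → ℝ) (Θ : Matrix (Fin m) (Fin m) ℝ) (μ : Fin m) : V m :=
  WithLp.toLp 2 fun ν => -2 * a μ * Θ μ ν

theorem inner_warpVector (a : Fin m → ℝ) (Θ : Matrix (Fin m) (Fin m) ℝ) (μ : Fin m) (x : V m) :
    inner ℝ (warpVector a Θ μ) x = -2 * a μ * applyMatrix Θ x μ := by
  rw [PiLp.inner_apply]
  simp only [warpVector, applyMatrix, Matrix.mulVec, dotProduct, Finset.mul_sum]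
  refine Finset.sum_congr rfl fun ν _ => ?_
  simp
  ring

theorem smul_warpedIntegrand (a q : Fin m → ℝ) (Θ : Matrix (Fin m) (Fin m) ℝ) (μ : Fin m)
    (Φ : 𝓢(V m, ℂ)) (χ : 𝓢(WithLp 2 (V m × V m), ℂ)) (ε : ℝ) (z : V m × V m) :
    (((2 * Real.pi) ^ m)⁻¹ : ℝ) • warpedIntegrand a Θ (diffOp a q μ * diffOp a q μ) Φ χ ε z
      = warpWeight (warpVector a Θ μ) (fun z => χ (WithLp.toLp 2 z)) ε z •
        phaseOp a ((2 * Real.pi)⁻¹ • z.2) (ofSchwartz (diffOp a q μ (diffOp a q μ Φ))) := by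
  have hπ := Real.pi_pos
  have h1 : ∀ (c : ℂ) (φ : 𝓢(V m, ℂ)), ofSchwartz (c • φ) = c • ofSchwartz φ := fun c φ =>
    (SchwartzMap.toLpCLM ℂ ℂ 2 (volume : Measure (V m))).map_smul c φ
  rw [warpedIntegrand, adjAction_diffOp, h1, map_smul, phaseOp, smul_inv_smul₀ (by positivity),
    ← ofReal_smul_hilb, smul_smul, smul_smul, warpWeight, inner_warpVector, mul_assoc]
  congr 2
  rw [PiLp.inner_apply]
  congr 4
  simp [mul_comm]

/-- The adjoint action contributes only a scalar, so the integrand is the one of `tendsto_warp_iff`.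
Absolute convergence is automatic; the domain is decided by the limit alone. -/
theorem hasWarpedConvolution_iff (a q : Fin m → ℝ) (Θ : Matrix (Fin m) (Fin m) ℝ) (μ : Fin m)
    (Φ : 𝓢(V m, ℂ)) (w : Hilb m) :
    HasWarpedConvolution a Θ (diffOp a q μ * diffOp a q μ) Φ w
      ↔ HasFunctionValue a (fun x => Real.exp (-2 * a μ * applyMatrix Θ x μ))
        (ofSchwartz (diffOp a q μ (diffOp a q μ Φ))) w := by
  have hπ := Real.pi_pos
  have hc : (((2 * Real.pi) ^ m)⁻¹ : ℝ) ≠ 0 := by positivity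
  simp only [← inner_warpVector]
  rw [← tendsto_warp_iff]
  refine forall_congr' fun χ => forall_congr' fun hχ => ?_
  have hp := hχ.cutoffPair
  have hint : ∀ ε : ℝ, 0 < ε → Integrable
      (warpedIntegrand a Θ (diffOp a q μ * diffOp a q μ) Φ χ ε) := by
    intro ε hε
    refine (integrable_smul_iff hc _).1 ?_
    refine Integrable.congr (integrable_smul_phaseOp a
      (integrable_warpWeight (warpVector a Θ μ) hp.continuous_left hp.decay_left hε)
      (τ := fun z : V m × V m => (2 * Real.pi)⁻¹ • z.2) (by fun_prop) _)
      (Filter.Eventually.of_forall fun z => (smul_warpedIntegrand a q Θ μ Φ χ ε z).symm)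
  rw [and_iff_right hint]
  refine Filter.tendsto_congr fun ε => ?_
  rw [← integral_smul]
  exact integral_congr_ae (Filter.Eventually.of_forall (smul_warpedIntegrand a q Θ μ Φ χ ε))

/-! ### Functions of `X` -/

theorem schwartzFunction_const_smul (a : Fin m → ℝ) (c : ℂ) (g : 𝓢(V m, ℂ)) (w : Hilb m) :
    schwartzFunction a (c • g) w = c • schwartzFunction a g w := by
  rw [schwartzFunction_eq, schwartzFunction_eq, FourierTransform.fourier_smul, ← integral_smul]
  refine integral_congr_ae (Filter.Eventually.of_forall fun p => ?_)
  simp [smul_smul]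

theorem schwartzFunction_smul (a : Fin m → ℝ) (c : ℂ) (g : 𝓢(V m, ℂ)) (w : Hilb m) :
    schwartzFunction a g (c • w) = c • schwartzFunction a g w :=
  (schwartzFunctionCLM a g).map_smul c w

theorem HasFunctionValue.const_mul {a : Fin m → ℝ} {f : V m → ℝ} {v w : Hilb m}
    (h : HasFunctionValue a f v w) (c : ℝ) : HasFunctionValue a (fun x => f x * c) v (c • w) := by
  intro g k hk
  rw [h ((c : ℂ) • g) k fun x => by rw [hk]; simp; ring, schwartzFunction_const_smul,
    ← ofReal_smul_hilb, schwartzFunction_smul]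

theorem HasFunctionValue.const_smul {a : Fin m → ℝ} {f : V m → ℝ} {v w : Hilb m}
    (h : HasFunctionValue a f v w) (c : ℂ) : HasFunctionValue a f (c • v) (c • w) := by
  intro g k hk
  rw [schwartzFunction_smul, schwartzFunction_smul, h g k hk]

theorem hasFunctionValue_zero (a : Fin m → ℝ) (v : Hilb m) :
    HasFunctionValue a (fun _ => 0) v 0 := by
  intro g k hk
  have h : k = (0 : ℂ) • g := by ext x; rw [hk]; simp
  rw [h, schwartzFunction_const_smul, zero_smul]
  exact (map_zero (schwartzFunctionCLM a g)).symm

/-- The value of `f(X)` is given by a relation, so its uniqueness needs the separation property.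
This removes the off-diagonal terms of a line element. -/
theorem HasFunctionValue.eq_zero {a : Fin m → ℝ} {v w : Hilb m}
    (h : HasFunctionValue a (fun _ => 0) v w) : w = 0 :=
  eq_of_schwartzFunction_eq a 0 fun g l _ => by
    rw [← h g ((0 : ℂ) • g) (fun x => by simp),
      hasFunctionValue_zero a v g ((0 : ℂ) • g) (fun x => by simp)]

theorem hasFunctionValue_one (a : Fin m → ℝ) (v : Hilb m) :
    HasFunctionValue a (fun _ => 1) v v := by
  intro g k hk
  have h : k = g := by ext x; rw [hk]; simp
  rw [h]

theorem HasFunctionValue.eq_of_one {a : Fin m → ℝ} {v w : Hilb m}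
    (h : HasFunctionValue a (fun _ => 1) v w) : w = v :=
  eq_of_schwartzFunction_eq a 0 fun g l _ => (h g g fun x => by simp).symm

/-! ### Vectors in the domain -/

/-- The linear form that shifts Gaussians by the factor of the squared `μ`-th derivative. -/
def shiftVector (a : Fin m → ℝ) (b : ℝ) (μ : Fin m) : Fin m → ℂ :=
  Pi.single μ (4 * b * Complex.I * a μ)

/-- Two derivatives multiply the transform by `e^{4π a_μ p_μ}`. In `fourier_gaussS` this is the
effect of a linear coefficient `z_μ` with `-(iπ/b) z_μ = 4π a_μ`, that is `z_μ = 4 i b a_μ`; `κ`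
cancels the constant `e^{z_μ²/(4b)}`. -/
theorem derivWeight_fourier_gaussS (a : Fin m → ℝ) {b : ℝ} (hb : 0 < b) (μ : Fin m) :
    ∃ κ : ℂ, ∀ p, derivWeight a μ (derivWeight a μ (𝓕 (gaussS hb 0 : 𝓢(V m, ℂ)) : 𝓢(V m, ℂ))) p
      = κ * (𝓕 (gaussS hb (linForm (shiftVector a b μ))) : 𝓢(V m, ℂ)) p := by
  have h0 : (0 : V m →L[ℝ] ℂ) = linForm 0 := by
    ext x; simp [linForm_apply]
  refine ⟨(Complex.exp ((∑ j, shiftVector a b μ j ^ 2) / (4 * b)))⁻¹, fun p => ?_⟩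
  rw [derivWeight, derivWeight, h0, fourier_gaussS, fourier_gaussS]
  have hb' : (b : ℂ) ≠ 0 := by exact_mod_cast hb.ne'
  have h1 : (linForm fun j => -(Complex.I * Real.pi / b) * shiftVector a b μ j) p
      = 2 * (a μ * (2 * Real.pi * p μ)) := by
    rw [linForm_apply, Finset.sum_eq_single μ (fun j _ hj => by simp [shiftVector, hj]) (by simp)]
    rw [shiftVector, Pi.single_eq_same]
    field_simp
    linear_combination (-4 * (a μ : ℂ) * p μ) * Complex.I_mul_I
  have h2 : (linForm fun j => -(Complex.I * Real.pi / b) * (0 : Fin m → ℂ) j) p = 0 := by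
    simp [linForm_apply]
  rw [gaussFun, gaussFun, h1, h2, add_zero, Complex.exp_add]
  have hE := Complex.exp_ne_zero ((∑ j, shiftVector a b μ j ^ 2) / (4 * b))
  have h3 : ((Real.exp (a μ * ((2 * Real.pi) • p) μ) : ℝ) : ℂ)
      = Complex.exp (a μ * (2 * Real.pi * p μ)) := by simp
  have h4 : Complex.exp ((∑ j, (0 : Fin m → ℂ) j ^ 2) / (4 * b)) = 1 := by simp
  have h5 : Complex.exp (2 * (a μ * (2 * Real.pi * p μ)))
      = Complex.exp (a μ * (2 * Real.pi * p μ)) ^ 2 := by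
    rw [← Complex.exp_nat_mul, Nat.cast_ofNat]
  rw [h3, h4, h5]
  generalize Complex.exp ((∑ j, shiftVector a b μ j ^ 2) / (4 * b)) = E at hE ⊢
  generalize Complex.exp (a μ * (2 * Real.pi * p μ)) = Y
  generalize (Real.pi / b : ℂ) ^ (m / 2 : ℂ) = C
  field_simp

/-- Multiplication by `e^{k·x}` only shifts the linear coefficient of a Gaussian, so the range of
its functional calculus lies in the domain of `e^{k·X}`. -/
theorem hasFunctionValue_gaussS (a : Fin m → ℝ) {b : ℝ} (hb : 0 < b) (z : Fin m → ℂ) (k : V m)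
    (v : Hilb m) :
    HasFunctionValue a (fun x => Real.exp (inner ℝ k x)) (schwartzFunction a (gaussS hb (linForm z)) v)
      (schwartzFunction a (gaussS hb (linForm (z + fun j => (k j : ℂ)))) v) := by
  intro g l hl
  refine schwartzFunction_comp_eq a _ _ _ _ v fun s => ?_
  rw [hl, gaussS_apply, gaussS_apply, gaussFun, gaussFun, linForm_apply, linForm_apply]
  simp only [Pi.add_apply, add_mul, Finset.sum_add_distrib, ← add_assoc]
  rw [Complex.exp_add _ (∑ j, (k j : ℂ) * s j), Complex.ofReal_exp, PiLp.inner_apply]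
  have : ((∑ j, inner ℝ (k j) (s j) : ℝ) : ℂ) = ∑ j, (k j : ℂ) * s j := by
    push_cast
    exact Finset.sum_congr rfl fun j _ => by simp [mul_comm]
  rw [this]
  ring

theorem exists_gaussian_regularization (a : Fin m → ℝ) (φ : 𝓢(V m, ℂ)) {b : ℝ} (hb : 0 < b) :
    ∃ Φ : 𝓢(V m, ℂ), ofSchwartz Φ = schwartzFunction a (gaussS hb 0) (ofSchwartz φ) ∧
      ∀ (q : Fin m → ℝ) (μ : Fin m) (k : V m), ∃ w, HasFunctionValue a
        (fun x => Real.exp (inner ℝ k x)) (ofSchwartz (diffOp a q μ (diffOp a q μ Φ))) w := by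
  have hsm : ∀ (c : ℂ) (φ : 𝓢(V m, ℂ)), ofSchwartz (c • φ) = c • ofSchwartz φ := fun c φ =>
    (SchwartzMap.toLpCLM ℂ ℂ 2 (volume : Measure (V m))).map_smul c φ
  have hG : SuperexpDecay (𝓕 (gaussS hb 0 : 𝓢(V m, ℂ)) : 𝓢(V m, ℂ)) := by
    have h0 : (0 : V m →L[ℝ] ℂ) = linForm 0 := by
      ext x; simp [linForm_apply]
    intro c
    obtain ⟨C, hC⟩ := superexpDecay_gaussFun (E := V m) (b := Real.pi ^ 2 / b)
      (by have := Real.pi_pos; positivity)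
      (linForm fun j => -(Complex.I * Real.pi / b) * (0 : Fin m → ℂ) j) c
    refine ⟨‖(Real.pi / b : ℂ) ^ (m / 2 : ℂ) *
      Complex.exp ((∑ j, (0 : Fin m → ℂ) j ^ 2) / (4 * b))‖ * C, fun p => ?_⟩
    rw [h0, fourier_gaussS, norm_mul, mul_assoc]
    gcongr
    exact hC p
  have hc : Continuous (𝓕 (gaussS hb 0 : 𝓢(V m, ℂ)) : 𝓢(V m, ℂ)) := SchwartzMap.continuous _
  refine ⟨smearS a hc hG φ, ?_, fun q μ k => ?_⟩
  · rw [ofSchwartz_smearS, schwartzFunction_eq]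
  · obtain ⟨κ, hκ⟩ := derivWeight_fourier_gaussS a hb μ
    -- The derivatives move onto `φ` and alter the weight, which by `hκ` is again the transform of a
    -- Gaussian.
    rw [diffOp_diffOp_apply, momOp_smearS, momOp_smearS, hsm, ofSchwartz_smearS]
    simp only [hκ, mul_smul]
    rw [integral_smul, ← schwartzFunction_eq]
    exact ⟨_, ((hasFunctionValue_gaussS a hb _ k _).const_smul κ).const_smul _⟩

/-- The Gaussian regularizations of Schwartz functions are dense. -/
theorem dense_regular (a q : Fin m → ℝ) (k : Fin m → V m) :
    Dense {f : Hilb m | ∃ Φ, (∀ μ, ∃ w, HasFunctionValue a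
      (fun x => Real.exp (inner ℝ (k μ) x)) (ofSchwartz (diffOp a q μ (diffOp a q μ Φ))) w) ∧
        f = ofSchwartz Φ} := by
  -- It suffices that every Schwartz function is a limit of regular ones, namely of its own
  -- regularizations as `t → 0`.
  refine Dense.of_closure ((denseRange_ofSchwartz (m := m)).mono ?_)
  rintro _ ⟨φ, rfl⟩
  have hg : ∀ t : ℝ, 0 < t → ∃ gt : 𝓢(V m, ℂ), (∀ x, gt x = gaussS one_pos 0 (t • x)) ∧
      schwartzFunction a gt (ofSchwartz φ) ∈ {f : Hilb m | ∃ Φ, (∀ μ, ∃ w, HasFunctionValue a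
      (fun x => Real.exp (inner ℝ (k μ) x)) (ofSchwartz (diffOp a q μ (diffOp a q μ Φ))) w) ∧
        f = ofSchwartz Φ} := by
    intro t ht
    have ht2 : 0 < t ^ 2 := by positivity
    refine ⟨gaussS ht2 0, fun x => ?_, ?_⟩
    · rw [gaussS_apply, gaussS_apply, gaussFun, gaussFun, norm_smul, mul_pow]
      simp
    · obtain ⟨Φ, h1, h2⟩ := exists_gaussian_regularization a φ ht2
      exact ⟨Φ, fun μ => h2 q μ (k μ), h1.symm⟩
  choose! gt hgt using hg
  have h1 := tendsto_schwartzFunction a (gaussS one_pos 0) gt (fun t ht => (hgt t ht).1)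
    (ofSchwartz φ)
  have h0 : (gaussS one_pos 0 : 𝓢(V m, ℂ)) 0 = 1 := by simp [gaussS_apply, gaussFun]
  rw [h0, one_smul] at h1
  exact mem_closure_of_tendsto h1 (by
    filter_upwards [self_mem_nhdsWithin] with t ht using (hgt t ht).2)

/-! ### Line elements in diagonal form -/

variable {n : ℕ}

theorem minkowski_ne {μ ν : Fin (n + 1)} (h : μ ≠ ν) : minkowski n μ ν = 0 :=
  Matrix.diagonal_apply_ne _ h

theorem minkowski_zero : minkowski n 0 0 = 1 := by simp [minkowski]

theorem minkowski_succ (i : Fin n) : minkowski n i.succ i.succ = -1 := by simp [minkowski]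

theorem minkowski_mul_self (μ : Fin (n + 1)) : minkowski n μ μ * minkowski n μ μ = 1 := by
  cases μ using Fin.cases with
  | zero => rw [minkowski_zero, one_mul]
  | succ i => rw [minkowski_succ]; norm_num

theorem minkowski_self_ne (μ : Fin (n + 1)) : minkowski n μ μ ≠ 0 := fun h => by
  have := minkowski_mul_self μ
  simp [h] at this

/-- `Φ` lies in the domain of all the `exp(-2 a_μ (Θ X)_μ) (dX^μ)²`, and their sum with the signs of
the Minkowski metric has the value `v` on `Φ`. -/
def HasDiagonalLineElement (a q : Fin (n + 1) → ℝ) (Θ : Matrix (Fin (n + 1)) (Fin (n + 1)) ℝ)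
    (Φ : 𝓢(V (n + 1), ℂ)) (v : Hilb (n + 1)) : Prop :=
  ∃ w : Fin (n + 1) → Hilb (n + 1),
    (∀ μ, HasFunctionValue a (fun x => Real.exp (-2 * a μ * applyMatrix Θ x μ))
      (ofSchwartz (diffOp a q μ (diffOp a q μ Φ))) (w μ)) ∧
    v = ∑ μ, minkowski n μ μ • w μ

theorem hasDeformedLineElement_iff (a q : Fin (n + 1) → ℝ)
    (Θ : Matrix (Fin (n + 1)) (Fin (n + 1)) ℝ) (Φ : 𝓢(V (n + 1), ℂ)) (v : Hilb (n + 1)) :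
    HasDeformedLineElement a q Θ Φ v ↔ HasDiagonalLineElement a q Θ Φ v := by
  have hsum : ∀ w : Fin (n + 1) → Fin (n + 1) → Hilb (n + 1),
      ∑ μ, ∑ ν, minkowski n μ ν • w μ ν = ∑ μ, minkowski n μ μ • w μ μ := fun w =>
    Finset.sum_congr rfl fun μ _ => Finset.sum_eq_single μ
      (fun ν _ hν => by rw [minkowski_ne hν.symm, zero_smul]) (by simp)
  constructor
  · rintro ⟨w, hw, rfl⟩
    exact ⟨fun μ => w μ μ, fun μ =>
      (hasWarpedConvolution_iff a q Θ μ Φ _).1 (hw μ μ (minkowski_self_ne μ)), hsum w⟩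
  · rintro ⟨w, hw, rfl⟩
    refine ⟨fun μ _ => w μ, fun μ ν hμν => ?_, (hsum fun μ _ => w μ).symm⟩
    obtain rfl : μ = ν := by
      by_contra h
      exact hμν (minkowski_ne h)
    exact (hasWarpedConvolution_iff a q Θ μ Φ _).2 (hw μ)

theorem hasLineElement_deformedMetric_iff (a q : Fin (n + 1) → ℝ)
    (Θ : Matrix (Fin (n + 1)) (Fin (n + 1)) ℝ) (Φ : 𝓢(V (n + 1), ℂ)) (v : Hilb (n + 1)) :
    HasLineElement a q (deformedMetric a Θ) Φ v ↔ HasDiagonalLineElement a q Θ Φ v := by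
  have hoff : ∀ μ ν, μ ≠ ν → (fun x => deformedMetric a Θ x μ ν) = fun _ => 0 := by
    intro μ ν h
    funext x
    simp [deformedMetric, minkowski_ne h]
  constructor
  · rintro ⟨w, hw, rfl⟩
    -- The sign sits inside the metric coefficient on one side and outside the operator on the
    -- other; as its square is `1`, multiplying by it converts either way.
    refine ⟨fun μ => minkowski n μ μ • w μ μ, fun μ => ?_, Finset.sum_congr rfl fun μ _ => ?_⟩
    · have h := (hw μ μ).const_mul (minkowski n μ μ)
      simpa only [deformedMetric, Matrix.of_apply, mul_assoc, minkowski_mul_self, mul_one] using h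
    · rw [smul_smul, minkowski_mul_self, one_smul]
      refine Finset.sum_eq_single μ (fun ν _ hν => ?_) (by simp)
      have h := hw μ ν
      rw [hoff μ ν hν.symm] at h
      exact h.eq_zero
  · rintro ⟨w, hw, rfl⟩
    refine ⟨fun μ ν => if μ = ν then minkowski n μ μ • w μ else 0, fun μ ν => ?_, by simp⟩
    by_cases h : μ = ν
    · subst h
      beta_reduce
      rw [if_pos rfl]
      exact (hw μ).const_mul (minkowski n μ μ)
    · beta_reduce
      rw [if_neg h, hoff μ ν h]
      exact hasFunctionValue_zero a _

section UltraStatic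

variable {a : Fin (n + 1) → ℝ} {Θ : Matrix (Fin (n + 1)) (Fin (n + 1)) ℝ}

theorem applyMatrix_zero_eq (hΘ : Θ.transpose = -Θ) (hΘ0 : ∀ j : Fin n, Θ 0 j.succ = 0)
    (x : V (n + 1)) : applyMatrix Θ x 0 = 0 := by
  have h00 : Θ 0 0 = 0 := by
    have := congrFun (congrFun hΘ 0) 0
    simp only [Matrix.transpose_apply, Matrix.neg_apply] at this
    linarith
  simp [applyMatrix, Matrix.mulVec, dotProduct, Fin.sum_univ_succ, hΘ0, h00]

theorem applyMatrix_succ_eq (hΘ : Θ.transpose = -Θ) (hΘ0 : ∀ j : Fin n, Θ 0 j.succ = 0)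
    (x : V (n + 1)) (i : Fin n) :
    applyMatrix Θ x i.succ = ∑ j : Fin n, Θ i.succ j.succ * spatial x j := by
  -- Skew-symmetry carries the vanishing of row `0` over to column `0`; this makes the spatial
  -- metric independent of time.
  have h0 : Θ i.succ 0 = 0 := by
    have := congrFun (congrFun hΘ 0) i.succ
    simp only [Matrix.transpose_apply, Matrix.neg_apply, hΘ0, neg_zero] at this
    exact this
  simp [applyMatrix, Matrix.mulVec, dotProduct, Fin.sum_univ_succ, h0, spatial]

theorem isUltraStatic_deformedMetric (hΘ : Θ.transpose = -Θ)
    (hΘ0 : ∀ j : Fin n, Θ 0 j.succ = 0) :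
    IsUltraStatic (deformedMetric a Θ) (spatialMetric a Θ) := by
  refine ⟨fun i j => ?_, fun x => Matrix.PosDef.diagonal fun i => Real.exp_pos _, fun x =>
    ⟨?_, fun i => ⟨?_, ?_⟩, fun i j => ?_⟩⟩
  · by_cases h : i = j
    · subst h
      simp only [spatialMetric, Matrix.diagonal_apply_eq]
      fun_prop
    · simp only [spatialMetric, Matrix.diagonal_apply_ne _ h]
      exact contDiff_const
  · simp [deformedMetric, applyMatrix_zero_eq hΘ hΘ0, minkowski_zero]
  · simp [deformedMetric, minkowski_ne (Fin.succ_ne_zero i).symm]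
  · simp [deformedMetric, minkowski_ne (Fin.succ_ne_zero i)]
  · by_cases h : i = j
    · subst h
      simp [deformedMetric, spatialMetric, minkowski_succ, applyMatrix_succ_eq hΘ hΘ0]
    · have h' : i.succ ≠ j.succ := fun e => h (Fin.succ_injective _ e)
      simp [deformedMetric, spatialMetric, minkowski_ne h', h]

theorem hasUltraStaticLineElement_iff (q : Fin (n + 1) → ℝ) (hΘ : Θ.transpose = -Θ)
    (hΘ0 : ∀ j : Fin n, Θ 0 j.succ = 0) (Φ : 𝓢(V (n + 1), ℂ)) (v : Hilb (n + 1)) :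
    HasUltraStaticLineElement a q (spatialMetric a Θ) Φ v
      ↔ HasDiagonalLineElement a q Θ Φ v := by
  have htime : (fun x : V (n + 1) => Real.exp (-2 * a 0 * applyMatrix Θ x 0)) = fun _ => 1 := by
    funext x
    rw [applyMatrix_zero_eq hΘ hΘ0, mul_zero, Real.exp_zero]
  have hdiag : ∀ i : Fin n, (fun x : V (n + 1) => spatialMetric a Θ (spatial x) i i)
      = fun x => Real.exp (-2 * a i.succ * applyMatrix Θ x i.succ) := by
    intro i
    funext x
    rw [applyMatrix_succ_eq hΘ hΘ0, spatialMetric, Matrix.diagonal_apply_eq]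
  have hoff : ∀ i j : Fin n, i ≠ j →
      (fun x : V (n + 1) => spatialMetric a Θ (spatial x) i j) = fun _ => 0 := by
    intro i j h
    funext x
    rw [spatialMetric, Matrix.diagonal_apply_ne _ h]
  constructor
  · rintro ⟨w, hw, rfl⟩
    -- The time coefficient is the constant `1`, so `dT²` imposes no domain condition and its value
    -- is the vector itself.
    refine ⟨Fin.cons (ofSchwartz (diffOp a q 0 (diffOp a q 0 Φ))) fun i => w i i, fun μ => ?_, ?_⟩
    · cases μ using Fin.cases with
      | zero =>
        rw [htime]
        exact hasFunctionValue_one a _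
      | succ i =>
        rw [← hdiag]
        exact hw i i
    · rw [Fin.sum_univ_succ, minkowski_zero, one_smul, Fin.cons_zero, sub_eq_add_neg,
        ← Finset.sum_neg_distrib]
      congr 1
      refine Finset.sum_congr rfl fun i _ => ?_
      rw [minkowski_succ, Fin.cons_succ, neg_one_smul]
      congr 1
      refine Finset.sum_eq_single i (fun j _ hj => ?_) (by simp)
      have h := hw i j
      rw [hoff i j hj.symm] at h
      exact h.eq_zero
  · rintro ⟨w, hw, rfl⟩
    refine ⟨fun i j => if i = j then w i.succ else 0, fun i j => ?_, ?_⟩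
    · by_cases h : i = j
      · subst h
        beta_reduce
        rw [if_pos rfl, hdiag]
        exact hw i.succ
      · beta_reduce
        rw [if_neg h, hoff i j h]
        exact hasFunctionValue_zero a _
    · have h0 := hw 0
      rw [htime] at h0
      rw [Fin.sum_univ_succ, minkowski_zero, one_smul, h0.eq_of_one, sub_eq_add_neg,
        ← Finset.sum_neg_distrib]
      simp [minkowski_succ]

end UltraStatic

/-! ### The flat line element as a whole -/

theorem ofSchwartz_sum_smul {m : ℕ} {ι : Type*} (s : Finset ι) (c : ι → ℂ)
    (φ : ι → 𝓢(V m, ℂ)) : ofSchwartz (∑ i ∈ s, c i • φ i) = ∑ i ∈ s, c i • ofSchwartz (φ i) := by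
  have h := map_sum (SchwartzMap.toLpCLM ℂ ℂ 2 (volume : Measure (V m))) (fun i => c i • φ i) s
  simp only [map_smul] at h
  exact h

/-- The regularized integral is linear in the operator, and the limit of a finite sum is the sum of
the limits. -/
theorem HasWarpedConvolution.sum {m : ℕ} {ι : Type*} {a : Fin m → ℝ}
    {Θ : Matrix (Fin m) (Fin m) ℝ} {Φ : 𝓢(V m, ℂ)} {A : ι → Module.End ℂ 𝓢(V m, ℂ)}
    {w : ι → Hilb m} (s : Finset ι) (c : ι → ℂ)
    (h : ∀ i ∈ s, HasWarpedConvolution a Θ (A i) Φ (w i)) :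
    HasWarpedConvolution a Θ (∑ i ∈ s, c i • A i) Φ (∑ i ∈ s, c i • w i) := by
  intro χ hχ
  have hI : ∀ ε, warpedIntegrand a Θ (∑ i ∈ s, c i • A i) Φ χ ε
      = fun z => ∑ i ∈ s, c i • warpedIntegrand a Θ (A i) Φ χ ε z := by
    intro ε
    funext z
    have h1 : adjAction a (applyMatrix Θ z.1) (∑ i ∈ s, c i • A i) Φ
        = ∑ i ∈ s, c i • adjAction a (applyMatrix Θ z.1) (A i) Φ := by
      simp only [adjAction, Finset.mul_sum, Finset.sum_mul, mul_smul_comm, smul_mul_assoc,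
        LinearMap.sum_apply, LinearMap.smul_apply]
    simp only [warpedIntegrand]
    rw [h1, ofSchwartz_sum_smul, map_sum, Finset.smul_sum]
    refine Finset.sum_congr rfl fun i _ => ?_
    rw [map_smul, smul_comm]
  have hint : ∀ ε : ℝ, 0 < ε → ∀ i ∈ s,
      Integrable fun z => c i • warpedIntegrand a Θ (A i) Φ χ ε z :=
    fun ε hε i hi => ((h i hi χ hχ).1 ε hε).smul (c i)
  refine ⟨fun ε hε => ?_, ?_⟩
  · rw [hI]
    exact integrable_finsetSum_of_normed s (hint ε hε)
  · refine (tendsto_finsetSum s fun i hi => ((h i hi χ hχ).2.const_smul (c i))).congr' ?_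
    filter_upwards [self_mem_nhdsWithin] with ε hε
    rw [hI, integral_finsetSum s (hint ε hε), Finset.smul_sum]
    refine Finset.sum_congr rfl fun i _ => ?_
    rw [integral_smul, smul_comm]

theorem flatLineElement_eq (a q : Fin (n + 1) → ℝ) :
    flatLineElement a q = ∑ μ, (minkowski n μ μ : ℂ) • (diffOp a q μ * diffOp a q μ) :=
  Finset.sum_congr rfl fun μ _ => Finset.sum_eq_single μ
    (fun ν _ hν => by rw [minkowski_ne hν.symm, Complex.ofReal_zero, zero_smul]) (by simp)

end WarpedLineElement

end

/-! ### The theorem on the deformed line element -/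

theorem mainTheorem4 {n : ℕ} (a q : Fin (n + 1) → ℝ) (ha : ∀ μ, a μ ≠ 0) (hq : q ≠ 0)
    (Θ : Matrix (Fin (n + 1)) (Fin (n + 1)) ℝ) (hΘ : Θ.transpose = -Θ)
    (hΘ0 : ∀ j : Fin n, Θ 0 j.succ = 0) :
    -- the deformed line element is that of the deformed metric
    (∀ Φ v, WarpedLineElement.HasDeformedLineElement a q Θ Φ v ↔
      WarpedLineElement.HasLineElement a q (WarpedLineElement.deformedMetric a Θ) Φ v) ∧
    -- the deformed metric is ultra-static, with the stated diagonal spatial metric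
    WarpedLineElement.IsUltraStatic (WarpedLineElement.deformedMetric a Θ)
      (WarpedLineElement.spatialMetric a Θ) ∧
    -- the deformed line element is `dt² - h_{ij}(x) dx^i dx^j`, as an equality of operators
    (∀ Φ v, WarpedLineElement.HasDeformedLineElement a q Θ Φ v ↔
      WarpedLineElement.HasUltraStaticLineElement a q
        (WarpedLineElement.spatialMetric a Θ) Φ v) ∧
    -- on its domain it is also the warped convolution of the whole flat line element
    (∀ Φ v, WarpedLineElement.HasDeformedLineElement a q Θ Φ v →
      WarpedLineElement.HasWarpedConvolution a Θ
        (WarpedLineElement.flatLineElement a q) Φ v) ∧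
    -- its domain is dense
    Dense {f : WarpedLineElement.Hilb (n + 1) | ∃ Φ v,
      WarpedLineElement.HasDeformedLineElement a q Θ Φ v ∧
        f = WarpedLineElement.ofSchwartz Φ} := by
  refine ⟨fun Φ v => ?_, WarpedLineElement.isUltraStatic_deformedMetric hΘ hΘ0, fun Φ v => ?_,
    fun Φ v h => ?_, ?_⟩
  · rw [WarpedLineElement.hasDeformedLineElement_iff,
      WarpedLineElement.hasLineElement_deformedMetric_iff]
  · rw [WarpedLineElement.hasDeformedLineElement_iff,
      WarpedLineElement.hasUltraStaticLineElement_iff q hΘ hΘ0]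
  · rw [WarpedLineElement.hasDeformedLineElement_iff] at h
    obtain ⟨w, hw, rfl⟩ := h
    rw [WarpedLineElement.flatLineElement_eq]
    have hsum := WarpedLineElement.HasWarpedConvolution.sum Finset.univ
      (fun μ => (WarpedLineElement.minkowski n μ μ : ℂ))
      (fun μ _ => (WarpedLineElement.hasWarpedConvolution_iff a q Θ μ Φ (w μ)).2 (hw μ))
    simpa only [WarpedLineElement.ofReal_smul_hilb] using hsum
  · refine (WarpedLineElement.dense_regular a q (WarpedLineElement.warpVector a Θ)).mono ?_
    rintro f ⟨Φ, hΦ, rfl⟩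
    choose w hw using hΦ
    refine ⟨Φ, _, (WarpedLineElement.hasDeformedLineElement_iff a q Θ Φ _).2
      ⟨w, fun μ => ?_, rfl⟩, rfl⟩
    simpa only [WarpedLineElement.inner_warpVector] using hw μ
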